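/- Let $\Bbbk$ be a field of characteristic $0$. A pair $(\Theta,\Delta)$, where $\Theta$ is a finite (crystallographic, not necessarily reduced or irreducible) root system and $\Delta\subset\Theta$ is a root subsystem, is called admissible if for every connected component $\Theta_c$ of $\Theta$: if $\Theta_c$ is reduced, then $\Theta_c\subset\Delta$; if $\Theta_c$ is not reduced, hence of type $\mathrm{BC}_n$, and $\Theta_{c,1},\Theta_{c,2},\Theta_{c,4}$ denote its sets of roots of square length $1,2,4$, then $\Delta\cap\Theta_c$ is $\Theta_{c,1}\cup\Theta_{c,2}$ or $\Theta_{c,2}\cup\Theta_{c,4}$. Let $(L,\mathfrak g)$ be a $(\Theta,\Delta)$-graded Lie algebra over $\Bbbk$ for an admissible pair $(\Theta,\Delta)$; that is, $L$ is a Lie algebra (of arbitrary dimension), $\mathfrak g\subset L$ is a finite-dimensional split semisimple subalgebra with a splitting Cartan subalgebra $\mathfrak h$ whose root system is $\Delta$ (so that $\Theta\subset\mathfrak h^*$), and with $L_\alpha=\{x\in L: [h,x]=\alpha(h)x \text{ for all } h\in\mathfrak h\}$ one has $L=\sum_{\alpha\in\Theta\cup\{0\}}L_\alpha$ and $L_0=\sum_{\alpha\in\Theta}[L_\alpha,L_{-\alpha}]$.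 Let $\Pi=\{\alpha_i\}_{i\in I}$ be a root basis of $\Delta$, with positive roots $\Delta_+$, let $h_i\in\mathfrak h$ be the coroot of $\alpha_i$, and choose $e_i\in\mathfrak g_{\alpha_i}$, $f_i\in\mathfrak g_{-\alpha_i}$ with $[e_i,f_i]=h_i$. Let $\Theta_+$ be a positive system of $\Theta$ with $\Theta_+\cap\Delta=\Delta_+$, let $L_+=\bigoplus_{\alpha\in\Theta_+}L_\alpha$, let $\mathbb N[\Theta_+]$ be the monoid spanned by $\Theta_+$, and write $\mu\preceq\lambda$ if $\lambda-\mu\in\mathbb N[\Theta_+]$. Let $\mathrm U(L)_0$ be the centralizer of $\mathfrak h$ in $\mathrm U(L)$ and $K=\mathrm U(L)L_+\cap \mathrm U(L)_0$. By the PBW theorem $\mathrm U(L)_0=\mathrm U(L_0)\oplus K$; let $\pi_0\colon \mathrm U(L)_0\to \mathrm U(L_0)$ be the projection with kernel $K$ (the Harish-Chandra projection). Let $\lambda\in\mathfrak h^*$ be dominant integral, i.e. $\ell_i:=\lambda(h_i)\in\mathbb N$ for all $i\in I$. * Let $J^\lambda$ be the two-sided ideal of $\mathrm U(L_0)$ generated,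 for all $i\in I$, by $h_i-\ell_i1$ and by all elements $\pi_0(x_1\cdots x_m\,y_1\cdots y_{\ell_i+1})$ with $m\in\mathbb N$, $x_j\in L_{\beta_j}$, $\beta_j\in\Theta_+$, $y_j\in L_{-\alpha_i}$ and $\sum_{j=1}^m\beta_j=(\ell_i+1)\alpha_i$. The Seligman algebra is $\mathbb S^\lambda=\mathrm U(L_0)/J^\lambda$. * Let $V(\lambda)$ be the finite-dimensional simple $\mathfrak g$-module of highest weight $\lambda$, that is, the quotient of $\mathrm U(\mathfrak g)$ by the left ideal generated by $\sum_{\alpha\in\Delta_+}\mathfrak g_\alpha$, all $h-\lambda(h)1$ $(h\in\mathfrak h)$ and all $f_i^{\ell_i+1}$ $(i\in I)$, with generator $v_\lambda$, the class of $1$. Let $P=\mathrm U(L)\otimes_{\mathrm U(\mathfrak g)}V(\lambda)$, let $W(\lambda)=P/\sum_{\mu\not\preceq\lambda}\mathrm U(L)P_\mu$ be the global Weyl module, where $P_\mu$ is the $\mu$-weight space of $P$, and let $w_\lambda\in W(\lambda)$ be the image of $1\otimes v_\lambda$. Then $J^\lambda=\mathrm{Ann}_{\mathrm U(L_0)}(w_\lambda)$.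 In particular $\mathrm{Ann}_{\mathrm U(L_0)}(w_\lambda)$ is a two-sided ideal of $\mathrm U(L_0)$, and the Seligman algebra $\mathbb S^\lambda=\mathrm U(L_0)/J^\lambda$ and the Chari–Pressley algebra $\mathbf A_\lambda=\mathrm U(L_0)/\mathrm{Ann}_{\mathrm U(L_0)}(w_\lambda)$ are the same quotient of $\mathrm U(L_0)$: the identity of $\mathrm U(L_0)$ induces an isomorphism of $\Bbbk$-algebras $\mathbb S^\lambda\cong\mathbf A_\lambda$. -/

import Mathlib

open TensorProduct

namespace RootGraded

attribute [local instance] LieRing.ofAssociativeRing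

section AdmissiblePairs

variable {k V N ι : Type*} [Field k] [AddCommGroup V] [Module k V] [AddCommGroup N] [Module k N]

/-- The set of roots of a root system. -/
def roots (P : RootPairing ι k V N) : Set V := Set.range P.root

/-- The connected component of the root with index `i`: all roots that can be reached from it
through a chain of roots in which neighbours are not orthogonal. -/
def component (P : RootPairing ι k V N) (i : ι) : Set V :=
  P.root '' {j | Relation.ReflTransGen (fun a b => P.pairing a b ≠ 0) i j}

/-- In a non-reduced component (type `BC_n`): the roots of square length 1, i.e. the roots `±ε_i`.
They are the roots whose double is a root. -/
def shortPart (C : Set V) : Set V := {a ∈ C | a + a ∈ C}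

/-- In a non-reduced component (type `BC_n`): the roots of square length 4, i.e. the roots `±2ε_i`.
They are the doubles of roots. -/
def extraLongPart (C : Set V) : Set V := {a ∈ C | ∃ b ∈ C, a = b + b}

/-- In a non-reduced component (type `BC_n`): the roots of square length 2, i.e. the roots
`±ε_i ± ε_j` with `i ≠ j`. They are the remaining roots. -/
def middlePart (C : Set V) : Set V := {a ∈ C | a ∉ shortPart C ∧ a ∉ extraLongPart C}

/-- A component is reduced if it does not contain a root together with its double. -/
def IsReducedSet (C : Set V) : Prop := ∀ a ∈ C, a + a ∉ C

/-- `(Θ, Δ)` is an admissible pair, `Θ` being the set of roots of `P`. -/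
structure IsAdmissiblePair (P : RootPairing ι k V N) (Δ : Set V) : Prop where
  subset : Δ ⊆ roots P
  of_reduced : ∀ i, IsReducedSet (component P i) → component P i ⊆ Δ
  of_not_reduced : ∀ i, ¬ IsReducedSet (component P i) →
    Δ ∩ component P i = shortPart (component P i) ∪ middlePart (component P i) ∨
    Δ ∩ component P i = middlePart (component P i) ∪ extraLongPart (component P i)

/-- `T` is a positive system of the root system with set of roots `Θ`. -/
structure IsPositiveSystem (Θ T : Set V) : Prop where
  add_mem : ∀ a ∈ T, ∀ b ∈ T, a + b ∈ Θ → a + b ∈ T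
  disjoint_neg : ∀ a ∈ T, -a ∉ T
  eq_union : Θ = T ∪ {a | -a ∈ T}

/-- `μ ⪯ λ`, i.e. `λ - μ` lies in the monoid `ℕ[Θ₊]` spanned by the positive system `T = Θ₊`. -/
def Below (T : Set V) (μ lam : V) : Prop := lam - μ ∈ AddSubmonoid.closure T

end AdmissiblePairs

section Enveloping

variable {k L : Type*} [Field k] [LieRing L] [LieAlgebra k L]

/-- The homomorphism `U(S) → U(L)` induced by the inclusion of a subalgebra `S` of `L`. -/
noncomputable def envMap (S : LieSubalgebra k L) :
    UniversalEnvelopingAlgebra k S →ₐ[k] UniversalEnvelopingAlgebra k L :=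
  UniversalEnvelopingAlgebra.lift k ((UniversalEnvelopingAlgebra.ι k).comp S.incl)

/-- The relations `u a ⊗ v = u ⊗ a v` (`a ∈ U(S)`) of the tensor product over `U(S)`. -/
def balancedRelations (S : LieSubalgebra k L) (V : Type*) [AddCommGroup V] [Module k V]
    [Module (UniversalEnvelopingAlgebra k S) V] :
    Submodule (UniversalEnvelopingAlgebra k L) (UniversalEnvelopingAlgebra k L ⊗[k] V) :=
  Submodule.span _ {z | ∃ (u : UniversalEnvelopingAlgebra k L)
    (a : UniversalEnvelopingAlgebra k S) (v : V),
      z = (u * envMap S a) ⊗ₜ[k] v - u ⊗ₜ[k] (a • v)}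

/-- The induced `U(L)`-module `P(V) = U(L) ⊗_{U(S)} V`. -/
abbrev Induced (S : LieSubalgebra k L) (V : Type*) [AddCommGroup V] [Module k V]
    [Module (UniversalEnvelopingAlgebra k S) V] : Type _ :=
  (UniversalEnvelopingAlgebra k L ⊗[k] V) ⧸ balancedRelations S V

end Enveloping

section Graded

variable {k L : Type*} [Field k] [LieRing L] [LieAlgebra k L] {g : LieSubalgebra k L}

/-- The weight space `L_μ = {x ∈ L : [h, x] = μ(h) x for all h ∈ 𝔥}`. -/
def wtSpace (H : LieSubalgebra k g) (μ : Module.Dual k H) : Submodule k L where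
  carrier := {x | ∀ h : H, ⁅((h : g) : L), x⁆ = μ h • x}
  add_mem' := by
    intro x y hx hy h
    rw [lie_add, hx h, hy h, smul_add]
  zero_mem' := by
    intro h
    rw [lie_zero, smul_zero]
  smul_mem' := by
    intro c x hx h
    rw [lie_smul, hx h, smul_comm]

/-- The weight space `L₀`, the centralizer of `𝔥` in `L`, as a subalgebra of `L`. -/
def zeroAlg (H : LieSubalgebra k g) : LieSubalgebra k L :=
  { wtSpace H 0 with
    lie_mem' := by
      intro x y hx hy h
      have h1 : ⁅((h : g) : L), x⁆ = 0 := by simpa using hx h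
      have h2 : ⁅((h : g) : L), y⁆ = 0 := by simpa using hy h
      rw [leibniz_lie, h1, h2]
      simp }

/-- The subspace `L₊ = ∑_{α ∈ Θ₊} L_α`, where `T = Θ₊`. -/
def posPart (H : LieSubalgebra k g) (T : Set (Module.Dual k H)) : Submodule k L :=
  ⨆ a ∈ T, wtSpace H a

/-- The weight space `M_μ` of a `U(L)`-module `M`. -/
def modWtSpace (H : LieSubalgebra k g) (M : Type*) [AddCommGroup M] [Module k M]
    [Module (UniversalEnvelopingAlgebra k L) M] (μ : Module.Dual k H) : Set M :=
  {m | ∀ h : H, UniversalEnvelopingAlgebra.ι k ((h : g) : L) • m = μ h • m}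

/-- The submodule `∑_{μ ⋠ λ} U(L) · M_μ` of a `U(L)`-module `M`. -/
def truncSubmodule (H : LieSubalgebra k g) (T : Set (Module.Dual k H)) (lam : Module.Dual k H)
    (M : Type*) [AddCommGroup M] [Module k M] [Module (UniversalEnvelopingAlgebra k L) M] :
    Submodule (UniversalEnvelopingAlgebra k L) M :=
  ⨆ μ ∈ {μ : Module.Dual k H | ¬ Below T μ lam},
    Submodule.span (UniversalEnvelopingAlgebra k L) (modWtSpace H M μ)

/-- The truncation `M^λ = M / ∑_{μ ⋠ λ} U(L) · M_μ`. -/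
abbrev Truncation (H : LieSubalgebra k g) (T : Set (Module.Dual k H)) (lam : Module.Dual k H)
    (M : Type*) [AddCommGroup M] [Module k M] [Module (UniversalEnvelopingAlgebra k L) M] :
    Type _ :=
  M ⧸ truncSubmodule H T lam M

/-- The weight space `U(L)_0` for the action `x ↦ (u ↦ x u - u x)` of `g` on `U(L)`. -/
def envZero (H : LieSubalgebra k g) : Submodule k (UniversalEnvelopingAlgebra k L) where
  carrier := {u | ∀ h : H, UniversalEnvelopingAlgebra.ι k ((h : g) : L) * u
    - u * UniversalEnvelopingAlgebra.ι k ((h : g) : L) = 0}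
  add_mem' := by
    intro x y hx hy h
    have h1 := hx h
    have h2 := hy h
    rw [sub_eq_zero] at h1 h2 ⊢
    rw [mul_add, add_mul, h1, h2]
  zero_mem' := by
    intro h
    simp
  smul_mem' := by
    intro c x hx h
    have h1 := hx h
    rw [mul_smul_comm, smul_mul_assoc, ← smul_sub, h1, smul_zero]

/-- The ideal `K = (U(L) L₊) ∩ U(L)_0` of `U(L)_0`. -/
noncomputable def hcKernel (H : LieSubalgebra k g) (T : Set (Module.Dual k H)) :
    Submodule k (UniversalEnvelopingAlgebra k L) :=
  (Submodule.span (UniversalEnvelopingAlgebra k L)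
    (UniversalEnvelopingAlgebra.ι k '' (posPart H T : Set L))).restrictScalars k ⊓ envZero H

/-- The graph of the Harish-Chandra projection `π₀ : U(L)_0 → U(L₀)`, i.e. of the projection onto
the first summand in the decomposition `U(L)_0 = U(L₀) ⊕ K` (a consequence of the PBW theorem):
`π₀(u) = p` if and only if `u - p ∈ K`. -/
def IsHCProjection (H : LieSubalgebra k g) (T : Set (Module.Dual k H))
    (u : UniversalEnvelopingAlgebra k L) (p : UniversalEnvelopingAlgebra k (zeroAlg H)) : Prop :=
  u ∈ envZero H ∧ u - envMap (zeroAlg H) p ∈ hcKernel H T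

end Graded

section Split

variable {k L : Type*} [Field k] [CharZero k] [LieRing L] [LieAlgebra k L]
  {g : LieSubalgebra k L} [FiniteDimensional k g] [LieAlgebra.IsSemisimple k g]
  (H : LieSubalgebra k g) [H.IsCartanSubalgebra] [LieModule.IsTriangularizable k H g]

/-- The root system `Δ ⊂ 𝔥*` of `(g, 𝔥)`, as a set. -/
noncomputable def delta : Set (Module.Dual k H) := roots (LieAlgebra.IsKilling.rootSystem H)

/-- `(L, g)` is a `(Θ, Δ)`-graded Lie algebra, where `Θ ⊂ 𝔥*` is the set of roots of `P` and `Δ` is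
the root system of `(g, 𝔥)`. -/
structure IsRootGraded {N ι : Type*} [AddCommGroup N] [Module k N]
    (P : RootPairing ι k (Module.Dual k H) N) : Prop where
  admissible : IsAdmissiblePair P (delta H)
  iSup_wtSpace : ⨆ a ∈ roots P ∪ {0}, wtSpace H a = ⊤
  zero_eq : wtSpace H 0 = Submodule.span k {z | ∃ a ∈ roots P, ∃ x ∈ wtSpace H a,
    ∃ y ∈ wtSpace H (-a), z = ⁅x, y⁆}

variable {H}

/-- The simple root `α_i`, for a root basis `b` of `Δ`. -/
noncomputable def simpleRoot (b : (LieAlgebra.IsKilling.rootSystem H).Base) (i : b.support) : Module.Dual k H :=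
  (LieAlgebra.IsKilling.rootSystem H).root i

/-- The element `h_i = h_{α_i}` of `𝔥`. -/
noncomputable def simpleCoroot (b : (LieAlgebra.IsKilling.rootSystem H).Base) (i : b.support) : H :=
  (LieAlgebra.IsKilling.rootSystem H).coroot i

/-- The positive roots `Δ₊ = Δ ∩ Q₊`. -/
noncomputable def deltaPos (b : (LieAlgebra.IsKilling.rootSystem H).Base) : Set (Module.Dual k H) :=
  delta H ∩ (AddSubmonoid.closure (Set.range (simpleRoot b)) : Set (Module.Dual k H))

/-- `h_i` as an element of `L₀`. -/
noncomputable def simpleCorootZero (b : (LieAlgebra.IsKilling.rootSystem H).Base) (i : b.support) :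
    zeroAlg H :=
  ⟨((simpleCoroot b i : g) : L), by
    intro h
    have h0 : ⁅h, simpleCoroot b i⁆ = 0 := trivial_lie_zero H H h (simpleCoroot b i)
    have h1 : ⁅((h : g) : L), ((simpleCoroot b i : g) : L)⁆
        = ((⁅h, simpleCoroot b i⁆ : H) : g) := rfl
    rw [h1, h0]
    simp⟩

/-- Root vectors `e_i ∈ g_{α_i}` and `f_i ∈ g_{-α_i}` with `[e_i, f_i] = h_i`. -/
structure IsChevalley (b : (LieAlgebra.IsKilling.rootSystem H).Base) (e f : b.support → g) :
    Prop where
  e_mem : ∀ i, (e i : L) ∈ wtSpace H (simpleRoot b i)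
  f_mem : ∀ i, (f i : L) ∈ wtSpace H (-simpleRoot b i)
  lie_e_f : ∀ i, ⁅e i, f i⁆ = (simpleCoroot b i : g)

/-- The left ideal `J(λ)` of `U(g)`, generated by `𝔫₊ = ∑_{α ∈ Δ₊} g_α`, the elements `h - λ(h)`
for `h ∈ 𝔥`, and the elements `f_i ^ (ℓ_i + 1)`, where `ℓ_i = λ(h_i)`. -/
noncomputable def simpleIdeal (b : (LieAlgebra.IsKilling.rootSystem H).Base) (f : b.support → g)
    (lam : Module.Dual k H) (l : b.support → ℕ) : Ideal (UniversalEnvelopingAlgebra k g) :=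
  Ideal.span
    ({z | ∃ a ∈ deltaPos b, ∃ x : g, (x : L) ∈ wtSpace H a ∧ z = UniversalEnvelopingAlgebra.ι k x} ∪
     {z | ∃ h : H, z = UniversalEnvelopingAlgebra.ι k (h : g) - algebraMap k _ (lam h)} ∪
     {z | ∃ i, z = UniversalEnvelopingAlgebra.ι k (f i) ^ (l i + 1)})

/-- The finite-dimensional simple `g`-module `V(λ) = U(g) / J(λ)` of highest weight `λ`. -/
abbrev SimpleModule (b : (LieAlgebra.IsKilling.rootSystem H).Base) (f : b.support → g)
    (lam : Module.Dual k H) (l : b.support → ℕ) : Type _ :=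
  UniversalEnvelopingAlgebra k g ⧸ simpleIdeal b f lam l

/-- The global Weyl module `W(λ) = (U(L) ⊗_{U(g)} V(λ))^λ`. -/
abbrev Weyl (b : (LieAlgebra.IsKilling.rootSystem H).Base) (T : Set (Module.Dual k H))
    (f : b.support → g) (lam : Module.Dual k H) (l : b.support → ℕ) : Type _ :=
  Truncation H T lam (Induced g (SimpleModule b f lam l))

/-- The generator `w_λ` of `W(λ)`, the image of `1 ⊗ v_λ`. -/
noncomputable def weylGen (b : (LieAlgebra.IsKilling.rootSystem H).Base)
    (T : Set (Module.Dual k H)) (f : b.support → g) (lam : Module.Dual k H) (l : b.support → ℕ) :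
    Weyl b T f lam l :=
  Submodule.Quotient.mk (Submodule.Quotient.mk
    ((1 : UniversalEnvelopingAlgebra k L) ⊗ₜ[k]
      (Submodule.Quotient.mk 1 : SimpleModule b f lam l)))

/-- The annihilator `Ann_{U(L₀)}(w_λ)`, a priori only a left ideal of `U(L₀)`. -/
noncomputable def weylAnn (b : (LieAlgebra.IsKilling.rootSystem H).Base)
    (T : Set (Module.Dual k H)) (f : b.support → g) (lam : Module.Dual k H) (l : b.support → ℕ) :
    Ideal (UniversalEnvelopingAlgebra k (zeroAlg H)) where
  carrier := {u | envMap (zeroAlg H) u • weylGen b T f lam l = 0}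
  add_mem' := by
    intro u v hu hv
    simp only [Set.mem_ofPred_eq] at hu hv ⊢
    rw [map_add, add_smul, hu, hv, add_zero]
  zero_mem' := by
    simp only [Set.mem_ofPred_eq]
    rw [map_zero, zero_smul]
  smul_mem' := by
    intro c u hu
    simp only [Set.mem_ofPred_eq] at hu ⊢
    rw [smul_eq_mul, map_mul, mul_smul, hu, smul_zero]

/-- The elements `π₀(x_1 ⋯ x_m y_1 ⋯ y_{ℓ_i + 1})` with `x_j ∈ L_{β_j}`, `β_j ∈ Θ₊`,
`y_j ∈ L_{-α_i}` and `∑ β_j = (ℓ_i + 1) α_i`. -/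
def projectedMonomials (b : (LieAlgebra.IsKilling.rootSystem H).Base)
    (T : Set (Module.Dual k H)) (l : b.support → ℕ) (i : b.support) :
    Set (UniversalEnvelopingAlgebra k (zeroAlg H)) :=
  {p | ∃ (m : ℕ) (β : Fin m → Module.Dual k H) (x : Fin m → L) (y : Fin (l i + 1) → L),
    (∀ j, β j ∈ T) ∧ (∀ j, x j ∈ wtSpace H (β j)) ∧
    (∀ j, y j ∈ wtSpace H (-simpleRoot b i)) ∧
    ∑ j, β j = (l i + 1) • simpleRoot b i ∧
    IsHCProjection H T
      ((List.ofFn fun j => UniversalEnvelopingAlgebra.ι k (x j)).prod *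
        (List.ofFn fun j => UniversalEnvelopingAlgebra.ι k (y j)).prod) p}

/-- The two-sided ideal `J^λ` of `U(L₀)`. -/
noncomputable def seligmanIdeal (b : (LieAlgebra.IsKilling.rootSystem H).Base)
    (T : Set (Module.Dual k H)) (l : b.support → ℕ) :
    Ideal (UniversalEnvelopingAlgebra k (zeroAlg H)) :=
  (TwoSidedIdeal.span (⋃ i : b.support, (projectedMonomials b T l i ∪
    {UniversalEnvelopingAlgebra.ι k (simpleCorootZero b i) - algebraMap k _ (l i : k)}))).asIdeal

instance seligmanIdeal_isTwoSided (b : (LieAlgebra.IsKilling.rootSystem H).Base)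
    (T : Set (Module.Dual k H)) (l : b.support → ℕ) : (seligmanIdeal b T l).IsTwoSided := by
  unfold seligmanIdeal
  infer_instance

/-- The Seligman algebra `S^λ = U(L₀) / J^λ`. -/
abbrev SeligmanAlgebra (b : (LieAlgebra.IsKilling.rootSystem H).Base)
    (T : Set (Module.Dual k H)) (l : b.support → ℕ) : Type _ :=
  UniversalEnvelopingAlgebra k (zeroAlg H) ⧸ seligmanIdeal b T l

/-- The Chari-Pressley algebra `A_λ = U(L₀) / Ann_{U(L₀)}(w_λ)`. -/
abbrev ChariPressleyAlgebra (b : (LieAlgebra.IsKilling.rootSystem H).Base)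
    (T : Set (Module.Dual k H)) (f : b.support → g) (lam : Module.Dual k H) (l : b.support → ℕ) :
    Type _ :=
  UniversalEnvelopingAlgebra k (zeroAlg H) ⧸ weylAnn b T f lam l

end Split

end RootGraded

open RootGraded

set_option autoImplicit false

/-! Write `w` for `w_λ`, and `I` (`weylIdeal`) for the left ideal of `U(L)` generated by `L₊`, all
`h - λ(h)` and all `f_i ^ (ℓ_i + 1)`. The two inclusions are proved separately.

`J^λ ⊆ Ann(w)`: every `m = u w` with `u ∈ U(L₀)` still comes from a vector of weight `λ`, so it
suffices that the generators of `J^λ` kill all such `m`; two-sidedness then comes for free. As `L₊`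
raises weights beyond `λ`, it kills `m`, so `π₀(x y)` acts on `m` as `x y`, where `y = y_1 ⋯
y_{ℓ_i+1}`. The vector `y m` has weight `λ - (ℓ_i + 1) α_i`. Since `f_i` is locally nilpotent on
`W(λ)`, `sl₂`-theory makes `e_i ^ (ℓ_i + 2)` injective on this weight space, but its values have
weight `λ + α_i` and hence vanish. Thus `y m = 0` (`mk_monomial_smul_eq_zero`,
`envMap_smul_mk_eq_zero_of_mem_seligmanIdeal`).

`Ann(w) ⊆ J^λ`: the weights of `U(L) / I` all lie below `λ`, so there is a map `W(λ) → U(L) / I`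
with `w ↦ 1` (`weylToQuotient`), and `z w = 0` forces `z ∈ I`. The Harish-Chandra projection extends
to a linear map `U(L) → U(L₀)` (`hcProj`) which is the identity on `U(L₀)` and kills `L₋ U(L)` and
`U(L) L₊`. It sends `I` into `J^λ` (`hcProj_mem_seligmanIdeal`): by the triangular decomposition
only products `x g` need testing, with `x` a positive monomial and `g` a generator of `I`. Hence `z
∈ J^λ`.

No PBW basis is used. The projection comes from an explicit action of `L = A ⊕ B` on `U(A)`, and of
the triangular decomposition only the spanning statement is needed. -/

namespace RootGraded

attribute [local instance] LieRing.ofAssociativeRing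

/-! ### Generation of the enveloping algebra by the Lie algebra. -/

section EnvelopingInduction

variable {k L : Type*} [Field k] [LieRing L] [LieAlgebra k L]

local notation "ι" => UniversalEnvelopingAlgebra.ι k

theorem adjoin_range_ι :
    Algebra.adjoin k (Set.range (ι : L → UniversalEnvelopingAlgebra k L)) = ⊤ := by
  set S := Algebra.adjoin k (Set.range (ι : L → UniversalEnvelopingAlgebra k L)) with hS
  let j : L →ₗ⁅k⁆ S :=
    { toFun := fun x => ⟨ι x, Algebra.subset_adjoin ⟨x, rfl⟩⟩
      map_add' := fun x y => Subtype.ext (map_add ι x y)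
      map_smul' := fun c x => Subtype.ext (map_smul ι c x)
      map_lie' := fun {x y} => Subtype.ext (LieHom.map_lie ι x y) }
  have h : S.val.comp (UniversalEnvelopingAlgebra.lift k j) = AlgHom.id k _ := by
    apply UniversalEnvelopingAlgebra.hom_ext
    ext x
    change (UniversalEnvelopingAlgebra.lift k j (ι x) : UniversalEnvelopingAlgebra k L) = ι x
    rw [UniversalEnvelopingAlgebra.lift_ι_apply]
    rfl
  refine eq_top_iff.2 fun u _ => ?_
  have h2 := AlgHom.congr_fun h u
  change (UniversalEnvelopingAlgebra.lift k j u : UniversalEnvelopingAlgebra k L) = u at h2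
  rw [← h2]
  exact Subtype.property _

/-- A subspace of a `U(L)`-module that is stable under a generating subspace of `L` is
stable under `U(L)`. -/
theorem smul_mem_of_ι_smul_mem {M : Type*} [AddCommGroup M] [Module k M]
    [Module (UniversalEnvelopingAlgebra k L) M] [IsScalarTower k (UniversalEnvelopingAlgebra k L) M]
    (S : Submodule k M) (h : ∀ x : L, ∀ m ∈ S, ι x • m ∈ S)
    (u : UniversalEnvelopingAlgebra k L) : ∀ m ∈ S, u • m ∈ S := by
  have hu : u ∈ Algebra.adjoin k (Set.range (ι : L → UniversalEnvelopingAlgebra k L)) := by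
    rw [adjoin_range_ι]; trivial
  induction hu using Algebra.adjoin_induction with
  | mem x hx => obtain ⟨y, rfl⟩ := hx; exact h y
  | algebraMap r => intro m hm; rw [algebraMap_smul]; exact S.smul_mem r hm
  | add a b _ _ ha hb => intro m hm; rw [add_smul]; exact S.add_mem (ha m hm) (hb m hm)
  | mul a b _ _ ha hb => intro m hm; rw [mul_smul]; exact ha _ (hb m hm)

@[elab_as_elim]
theorem enveloping_induction {p : UniversalEnvelopingAlgebra k L → Prop} (one : p 1)
    (add : ∀ a b, p a → p b → p (a + b)) (smul : ∀ (c : k) a, p a → p (c • a))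
    (ι_mul : ∀ x a, p a → p (ι x * a)) (u : UniversalEnvelopingAlgebra k L) : p u := by
  let S : Submodule k (UniversalEnvelopingAlgebra k L) :=
    { carrier := {u | p u}
      add_mem' := fun ha hb => add _ _ ha hb
      zero_mem' := by
        have := smul 0 1 one
        rwa [zero_smul] at this
      smul_mem' := fun c a ha => smul c a ha }
  have := smul_mem_of_ι_smul_mem S (fun x m hm => ι_mul x m hm) u 1 one
  rwa [smul_eq_mul, mul_one] at this

theorem ι_lie (x y : L) : ι ⁅x, y⁆ = ι x * ι y - ι y * ι x := by
  rw [LieHom.map_lie, LieRing.of_associative_ring_bracket]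

theorem ι_mul_ι (x y : L) : ι x * ι y = ι y * ι x + ι ⁅x, y⁆ := by
  rw [ι_lie]; abel

theorem envMap_ι (S : LieSubalgebra k L) (x : S) :
    envMap S (UniversalEnvelopingAlgebra.ι k x) = ι (x : L) :=
  UniversalEnvelopingAlgebra.lift_ι_apply k _ x

end EnvelopingInduction

/-! ### The action of `L = A ⊕ B` on `U(A)`, with `A` and `B` subalgebras. -/

section Splitting

variable {k L : Type*} [Field k] [LieRing L] [LieAlgebra k L] {A B : LieSubalgebra k L}
  (hAB : IsCompl A.toSubmodule B.toSubmodule)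

local notation "U" => UniversalEnvelopingAlgebra k A
local notation "ι" => UniversalEnvelopingAlgebra.ι k

/-- The projection onto `A` along `B`. -/
noncomputable def projLeft : L →ₗ[k] A := A.toSubmodule.projectionOnto B.toSubmodule hAB

/-- The projection onto `B` along `A`. -/
noncomputable def projRight : L →ₗ[k] B := B.toSubmodule.projectionOnto A.toSubmodule hAB.symm

theorem projLeft_coe (a : A) : projLeft hAB (a : L) = a :=
  Submodule.projectionOnto_apply_left hAB a

theorem projLeft_coe_right (a : B) : projLeft hAB (a : L) = 0 :=
  Submodule.projectionOnto_apply_right hAB a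

theorem projRight_coe (a : B) : projRight hAB (a : L) = a :=
  Submodule.projectionOnto_apply_left hAB.symm a

theorem projRight_coe_left (a : A) : projRight hAB (a : L) = 0 :=
  Submodule.projectionOnto_apply_right hAB.symm a

theorem projLeft_add_projRight (x : L) : (projLeft hAB x : L) + (projRight hAB x : L) = x := by
  exact Submodule.projection_add_projection_eq_self hAB x

/-- The second component of the operator of `a ∈ A` on `U(A) × Hom(B, U(A))`. -/
noncomputable def extActSnd (a : A) (u : U) (φ : B →ₗ[k] U) : B →ₗ[k] U where
  toFun x := ι a * φ x + ι (projLeft hAB ⁅(x : L), (a : L)⁆) * u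
    + φ (projRight hAB ⁅(x : L), (a : L)⁆)
  map_add' x y := by
    have : ((x + y : B) : L) = x + y := rfl
    rw [this, add_lie, map_add, map_add, map_add, map_add, map_add, mul_add, add_mul]
    abel
  map_smul' c x := by
    have : ((c • x : B) : L) = c • (x : L) := rfl
    rw [this, smul_lie, map_smul, map_smul, map_smul, map_smul, map_smul, mul_smul_comm,
      smul_mul_assoc, RingHom.id_apply, smul_add, smul_add]

/-- The operator of `a ∈ A` on `U(A) × Hom(B, U(A))`. -/
noncomputable def extAct (a : A) : Module.End k (U × (B →ₗ[k] U)) where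
  toFun p := (ι a * p.1, extActSnd hAB a p.1 p.2)
  map_add' p q := by
    refine Prod.ext (mul_add _ _ _) (LinearMap.ext fun x => ?_)
    change ι a * (p.2 x + q.2 x) + ι (projLeft hAB ⁅(x : L), (a : L)⁆) * (p.1 + q.1)
      + (p.2 (projRight hAB ⁅(x : L), (a : L)⁆) + q.2 (projRight hAB ⁅(x : L), (a : L)⁆))
      = (ι a * p.2 x + ι (projLeft hAB ⁅(x : L), (a : L)⁆) * p.1
          + p.2 (projRight hAB ⁅(x : L), (a : L)⁆))
        + (ι a * q.2 x + ι (projLeft hAB ⁅(x : L), (a : L)⁆) * q.1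
          + q.2 (projRight hAB ⁅(x : L), (a : L)⁆))
    rw [mul_add, mul_add]
    abel
  map_smul' c p := by
    refine Prod.ext (mul_smul_comm _ _ _) (LinearMap.ext fun x => ?_)
    change ι a * (c • p.2 x) + ι (projLeft hAB ⁅(x : L), (a : L)⁆) * (c • p.1)
      + c • p.2 (projRight hAB ⁅(x : L), (a : L)⁆)
      = c • (ι a * p.2 x + ι (projLeft hAB ⁅(x : L), (a : L)⁆) * p.1
          + p.2 (projRight hAB ⁅(x : L), (a : L)⁆))
    rw [mul_smul_comm, mul_smul_comm, smul_add, smul_add]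

theorem extAct_fst (a : A) (p : U × (B →ₗ[k] U)) : (extAct hAB a p).1 = ι a * p.1 := rfl

theorem extAct_snd (a : A) (p : U × (B →ₗ[k] U)) (x : B) :
    (extAct hAB a p).2 x = ι a * p.2 x + ι (projLeft hAB ⁅(x : L), (a : L)⁆) * p.1
      + p.2 (projRight hAB ⁅(x : L), (a : L)⁆) := rfl

/-- The `A`-component of the Jacobi identity. Together with `projRight_lie`, the `B`-component, this
is what makes `extAct` compatible with brackets. -/
theorem projLeft_lie (a a' : A) (x : L) :
    projLeft hAB ⁅x, ((⁅a, a'⁆ : A) : L)⁆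
      = ⁅projLeft hAB ⁅x, (a : L)⁆, a'⁆ + ⁅a, projLeft hAB ⁅x, (a' : L)⁆⁆
        + projLeft hAB ⁅(projRight hAB ⁅x, (a : L)⁆ : L), (a' : L)⁆
        - projLeft hAB ⁅(projRight hAB ⁅x, (a' : L)⁆ : L), (a : L)⁆ := by
  have h1 := projLeft_add_projRight hAB ⁅x, (a : L)⁆
  have h2 := projLeft_add_projRight hAB ⁅x, (a' : L)⁆
  rw [LieSubalgebra.coe_bracket, leibniz_lie x, map_add]
  conv_lhs => rw [← h1, ← h2]
  rw [add_lie, lie_add, map_add, map_add, ← LieSubalgebra.coe_bracket, ← LieSubalgebra.coe_bracket,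
    projLeft_coe, projLeft_coe, ← lie_skew (a : L), map_neg]
  abel

theorem projRight_lie (a a' : A) (x : L) :
    projRight hAB ⁅x, ((⁅a, a'⁆ : A) : L)⁆
      = projRight hAB ⁅(projRight hAB ⁅x, (a : L)⁆ : L), (a' : L)⁆
        - projRight hAB ⁅(projRight hAB ⁅x, (a' : L)⁆ : L), (a : L)⁆ := by
  have h1 := projLeft_add_projRight hAB ⁅x, (a : L)⁆
  have h2 := projLeft_add_projRight hAB ⁅x, (a' : L)⁆
  rw [LieSubalgebra.coe_bracket, leibniz_lie x, map_add]
  conv_lhs => rw [← h1, ← h2]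
  rw [add_lie, lie_add, map_add, map_add, ← LieSubalgebra.coe_bracket, ← LieSubalgebra.coe_bracket,
    projRight_coe_left, projRight_coe_left, ← lie_skew (a : L), map_neg]
  abel

/-- The `A`-module `U(A) × Hom(B, U(A))`. -/
noncomputable def extHom : A →ₗ⁅k⁆ Module.End k (U × (B →ₗ[k] U)) where
  toFun := extAct hAB
  map_add' a a' := by
    refine LinearMap.ext fun p => Prod.ext ?_ (LinearMap.ext fun x => ?_)
    · simp only [LinearMap.add_apply, Prod.fst_add, extAct_fst, map_add, add_mul]
    · have : ((a + a' : A) : L) = a + a' := rfl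
      simp only [LinearMap.add_apply, Prod.snd_add, extAct_snd, map_add, add_mul, this, lie_add]
      abel
  map_smul' c a := by
    refine LinearMap.ext fun p => Prod.ext ?_ (LinearMap.ext fun x => ?_)
    · simp only [LinearMap.smul_apply, Prod.smul_fst, extAct_fst, map_smul, RingHom.id_apply,
        smul_mul_assoc]
    · have : ((c • a : A) : L) = c • (a : L) := rfl
      simp only [LinearMap.smul_apply, Prod.smul_snd, extAct_snd, map_smul, RingHom.id_apply,
        smul_mul_assoc, this, lie_smul, smul_add]
  map_lie' {a a'} := by
    rw [LieRing.of_associative_ring_bracket]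
    refine LinearMap.ext fun p => Prod.ext ?_ (LinearMap.ext fun x => ?_)
    · simp only [LinearMap.sub_apply, Module.End.mul_apply, Prod.fst_sub, extAct_fst, ι_lie,
        sub_mul, mul_assoc]
    · simp only [LinearMap.sub_apply, Module.End.mul_apply, Prod.snd_sub, extAct_snd, extAct_fst]
      rw [projLeft_lie, projRight_lie]
      simp only [map_add, map_sub, ι_lie]
      noncomm_ring

/-- For `u ∈ U(A)`, the map `b ↦ b u`, where `U(A)` is identified with `U(L) / U(L) B`. -/
noncomputable def rightAct : U →ₗ[k] (B →ₗ[k] U) where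
  toFun u := (UniversalEnvelopingAlgebra.lift k (extHom hAB) u (1, 0)).2
  map_add' u v := by rw [map_add]; rfl
  map_smul' c u := by rw [map_smul]; rfl

theorem lift_extHom_fst (u : U) :
    (UniversalEnvelopingAlgebra.lift k (extHom hAB) u (1, 0)).1 = u := by
  induction u using enveloping_induction with
  | one => rw [map_one]; rfl
  | add a b ha hb => rw [map_add, LinearMap.add_apply, Prod.fst_add, ha, hb]
  | smul c a ha => rw [map_smul, LinearMap.smul_apply, Prod.smul_fst, ha]
  | ι_mul x a ha =>
    rw [map_mul, Module.End.mul_apply, UniversalEnvelopingAlgebra.lift_ι_apply]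
    change ι x * _ = _
    rw [ha]

theorem rightAct_one (x : B) : rightAct hAB 1 x = 0 := by
  change (UniversalEnvelopingAlgebra.lift k (extHom hAB) 1 (1, 0)).2 x = 0
  rw [map_one]; rfl

/-- The recursion `x (a u) = a (x u) + [x, a] u`, with `[x, a]` split along `A ⊕ B`. Because of the
relations in `U(A)` it cannot simply be taken as a definition. It is read off the orbit of `(1, 0)`
in the `A`-module `U(A) × Hom(B, U(A))`, whose first coordinate remembers `u`. -/
theorem rightAct_ι_mul (a : A) (u : U) (x : B) :
    rightAct hAB (ι a * u) x = ι a * rightAct hAB u x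
      + ι (projLeft hAB ⁅(x : L), (a : L)⁆) * u
      + rightAct hAB u (projRight hAB ⁅(x : L), (a : L)⁆) := by
  change (UniversalEnvelopingAlgebra.lift k (extHom hAB) (ι a * u) (1, 0)).2 x = _
  rw [map_mul, Module.End.mul_apply, UniversalEnvelopingAlgebra.lift_ι_apply]
  refine (extAct_snd hAB a _ x).trans ?_
  rw [lift_extHom_fst]
  rfl

/-- The operator of `x ∈ L` on `U(A)`, identified with `U(L) / U(L) B`. -/
noncomputable def splitAct : L →ₗ[k] Module.End k U where
  toFun x :=
    { toFun := fun u => ι (projLeft hAB x) * u + rightAct hAB u (projRight hAB x)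
      map_add' := fun u v => by
        rw [map_add, LinearMap.add_apply, mul_add]
        abel
      map_smul' := fun c u => by
        rw [map_smul, LinearMap.smul_apply, mul_smul_comm, RingHom.id_apply, smul_add] }
  map_add' x y := by
    refine LinearMap.ext fun u => ?_
    change ι (projLeft hAB (x + y)) * u + rightAct hAB u (projRight hAB (x + y))
      = (ι (projLeft hAB x) * u + rightAct hAB u (projRight hAB x))
        + (ι (projLeft hAB y) * u + rightAct hAB u (projRight hAB y))
    rw [map_add, map_add, map_add, map_add, add_mul]
    abel
  map_smul' c x := by
    refine LinearMap.ext fun u => ?_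
    change ι (projLeft hAB (c • x)) * u + rightAct hAB u (projRight hAB (c • x))
      = c • (ι (projLeft hAB x) * u + rightAct hAB u (projRight hAB x))
    rw [map_smul, map_smul, map_smul, map_smul, smul_mul_assoc, smul_add]

theorem splitAct_apply (x : L) (u : U) :
    splitAct hAB x u = ι (projLeft hAB x) * u + rightAct hAB u (projRight hAB x) := rfl

theorem splitAct_left (a : A) (u : U) : splitAct hAB (a : L) u = ι a * u := by
  rw [splitAct_apply, projLeft_coe, projRight_coe_left, map_zero, add_zero]

theorem splitAct_right (x : B) (u : U) : splitAct hAB (x : L) u = rightAct hAB u x := by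
  rw [splitAct_apply, projLeft_coe_right, projRight_coe, map_zero, zero_mul, zero_add]

theorem splitAct_ι_mul (a : A) (x : B) (u : U) :
    splitAct hAB (x : L) (ι a * u)
      = ι a * splitAct hAB (x : L) u + splitAct hAB ⁅(x : L), (a : L)⁆ u := by
  rw [splitAct_right, splitAct_right, rightAct_ι_mul, splitAct_apply, add_assoc]

/-- On `1` all terms vanish, because `B` is a subalgebra that kills `1`. For a product `a u`, both
operators are moved past `a` and the Jacobi identity is used. -/
theorem splitAct_lie_right (x y : B) (u : U) :
    splitAct hAB ⁅(x : L), (y : L)⁆ u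
      = splitAct hAB (x : L) (splitAct hAB (y : L) u)
        - splitAct hAB (y : L) (splitAct hAB (x : L) u) := by
  induction u using enveloping_induction generalizing x y with
  | one =>
    rw [← LieSubalgebra.coe_bracket]
    simp only [splitAct_right, rightAct_one, map_zero, sub_zero]
  | add a b ha hb => simp only [map_add, ha, hb]; abel
  | smul c a ha => simp only [map_smul, ha, smul_sub]
  | ι_mul a u hu =>
    -- The brackets `[x, a]` and `[y, a]` have components in both `A` and `B`. The induction
    -- hypothesis covers `B`, and `splitAct_ι_mul` covers `A`.
    have mixed : ∀ (z : B) (t : L), splitAct hAB ⁅(z : L), t⁆ u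
        = splitAct hAB (z : L) (splitAct hAB t u) - splitAct hAB t (splitAct hAB (z : L) u) := by
      intro z t
      have ht := projLeft_add_projRight hAB t
      rw [← ht, lie_add, map_add, map_add, LinearMap.add_apply, LinearMap.add_apply, map_add, hu,
        LinearMap.add_apply, splitAct_left, splitAct_left, splitAct_ι_mul]
      abel
    have jac : ⁅⁅(x : L), (y : L)⁆, (a : L)⁆
        = ⁅(x : L), ⁅(y : L), (a : L)⁆⁆ - ⁅(y : L), ⁅(x : L), (a : L)⁆⁆ := by
      rw [lie_lie]
    have h1 := splitAct_ι_mul hAB a ⁅x, y⁆ u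
    rw [LieSubalgebra.coe_bracket] at h1
    rw [h1, splitAct_ι_mul, splitAct_ι_mul, map_add, map_add, splitAct_ι_mul, splitAct_ι_mul, hu,
      jac, map_sub, LinearMap.sub_apply, mixed x ⁅(y : L), (a : L)⁆, mixed y ⁅(x : L), (a : L)⁆, mul_sub]
    abel

/-- The action of `L = A ⊕ B` on `U(A) ≅ U(L) / U(L) B`. -/
noncomputable def splitHom : L →ₗ⁅k⁆ Module.End k U where
  __ := splitAct hAB
  map_lie' {x y} := by
    rw [LieRing.of_associative_ring_bracket]
    refine LinearMap.ext fun u => ?_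
    change splitAct hAB ⁅x, y⁆ u
      = splitAct hAB x (splitAct hAB y u) - splitAct hAB y (splitAct hAB x u)
    have mixed : ∀ (a : A) (z : B), splitAct hAB ⁅(a : L), (z : L)⁆ u
        = splitAct hAB (a : L) (splitAct hAB (z : L) u)
          - splitAct hAB (z : L) (splitAct hAB (a : L) u) := by
      intro a z
      rw [← lie_skew, map_neg, LinearMap.neg_apply, splitAct_left, splitAct_left, splitAct_ι_mul]
      abel
    have hx := projLeft_add_projRight hAB x
    have hy := projLeft_add_projRight hAB y
    rw [← hx, ← hy]
    simp only [add_lie, lie_add, map_add, LinearMap.add_apply, splitAct_lie_right]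
    rw [mixed, ← lie_skew (projRight hAB x : L), map_neg, LinearMap.neg_apply, mixed,
      ← LieSubalgebra.coe_bracket]
    simp only [splitAct_left, ι_lie, sub_mul, mul_assoc]
    abel

/-- The linear projection `U(L) → U(A)` with kernel `U(L) B`, for `L = A ⊕ B`. -/
noncomputable def envProj : UniversalEnvelopingAlgebra k L →ₗ[k] U :=
  LinearMap.applyₗ 1 ∘ₗ (UniversalEnvelopingAlgebra.lift k (splitHom hAB)).toLinearMap

theorem envProj_one : envProj hAB 1 = 1 := by
  change UniversalEnvelopingAlgebra.lift k (splitHom hAB) 1 (1 : U) = 1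
  rw [map_one (UniversalEnvelopingAlgebra.lift k (splitHom hAB))]; rfl

theorem envProj_ι_mul (a : A) (u : UniversalEnvelopingAlgebra k L) :
    envProj hAB (ι (a : L) * u) = ι a * envProj hAB u := by
  change UniversalEnvelopingAlgebra.lift k (splitHom hAB) (ι (a : L) * u) 1 = _
  rw [map_mul, Module.End.mul_apply, UniversalEnvelopingAlgebra.lift_ι_apply]
  exact splitAct_left hAB a _

/-- `envProj` evaluates the action at `1 ∈ U(A)`, which `B` annihilates. -/
theorem envProj_mul_ι (u : UniversalEnvelopingAlgebra k L) (x : B) :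
    envProj hAB (u * ι (x : L)) = 0 := by
  change UniversalEnvelopingAlgebra.lift k (splitHom hAB) (u * ι (x : L)) 1 = _
  rw [map_mul, Module.End.mul_apply, UniversalEnvelopingAlgebra.lift_ι_apply]
  have : splitHom hAB (x : L) 1 = 0 := (splitAct_right hAB x 1).trans (rightAct_one hAB x)
  rw [this, map_zero]

end Splitting

/-! ### Triangular gradings and the spanning half of the triangular decomposition of `U(L)`. -/

section TriangularGrading

variable {k L V : Type*} [Field k] [LieRing L] [LieAlgebra k L]

/-- The sum of the homogeneous components with degree in `S`. -/
def partSum (W : V → Submodule k L) (S : Set V) : Submodule k L := ⨆ a ∈ S, W a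

theorem le_partSum (W : V → Submodule k L) {S : Set V} {a : V} (ha : a ∈ S) :
    W a ≤ partSum W S := le_iSup₂_of_le a ha le_rfl

theorem partSum_induction (W : V → Submodule k L) {S : Set V} {p : L → Prop} {x : L}
    (hx : x ∈ partSum W S) (mem : ∀ a ∈ S, ∀ y ∈ W a, p y) (zero : p 0)
    (add : ∀ y z, p y → p z → p (y + z)) : p x := by
  unfold partSum at hx
  rw [← iSup_subtype''] at hx
  exact Submodule.iSup_induction _ (motive := p) hx (fun a y hy => mem a a.2 y hy) zero add

local notation "ι" => UniversalEnvelopingAlgebra.ι k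

/-- The left ideal `U(L) L_S` generated by the components with degree in `S`. -/
noncomputable def leftSpan (W : V → Submodule k L) (S : Set V) :
    Submodule (UniversalEnvelopingAlgebra k L) (UniversalEnvelopingAlgebra k L) :=
  Submodule.span _ (ι '' (partSum W S : Set L))

theorem mul_ι_mem_leftSpan {W : V → Submodule k L} {S : Set V} (u : UniversalEnvelopingAlgebra k L)
    {x : L} (hx : x ∈ partSum W S) : u * ι x ∈ leftSpan W S :=
  Submodule.smul_mem _ u (Submodule.subset_span ⟨x, hx, rfl⟩)

variable [AddCommGroup V]

/-- A grading of `L` by an abelian group with support in `T ∪ {0} ∪ -T`, where no nonempty sum of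
elements of `T` vanishes. -/
structure IsTriangularGrading (W : V → Submodule k L) (T : Set V) : Prop where
  lie_mem : ∀ {a b x y}, x ∈ W a → y ∈ W b → ⁅x, y⁆ ∈ W (a + b)
  iSup_eq_top : ⨆ a, W a = ⊤
  indep : iSupIndep W
  eq_bot : ∀ a, a ≠ 0 → a ∉ T → -a ∉ T → W a = ⊥
  sum_ne_zero : ∀ s : Multiset V, s ≠ 0 → (∀ a ∈ s, a ∈ T) → s.sum ≠ 0

/-- `IsMonomial W S ν u` means that `u` is a product of homogeneous elements of `L` with degrees in
`S`, of total degree `ν`. -/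
inductive IsMonomial (W : V → Submodule k L) (S : Set V) :
    V → UniversalEnvelopingAlgebra k L → Prop
  | one : IsMonomial W S 0 1
  | cons {a ν : V} {x : L} {u : UniversalEnvelopingAlgebra k L} (ha : a ∈ S) (hx : x ∈ W a)
      (hu : IsMonomial W S ν u) : IsMonomial W S (a + ν) (ι x * u)

theorem IsMonomial.mul {W : V → Submodule k L} {S : Set V} {μ ν : V}
    {u v : UniversalEnvelopingAlgebra k L} (hu : IsMonomial W S μ u) (hv : IsMonomial W S ν v) :
    IsMonomial W S (μ + ν) (u * v) := by
  induction hu with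
  | one => rwa [zero_add, one_mul]
  | cons ha hx _ ih => rw [add_assoc, mul_assoc]; exact .cons ha hx ih

theorem IsMonomial.mono {W : V → Submodule k L} {S S' : Set V} (h : S ⊆ S') {ν : V}
    {u : UniversalEnvelopingAlgebra k L} (hu : IsMonomial W S ν u) : IsMonomial W S' ν u := by
  induction hu with
  | one => exact .one
  | cons ha hx _ ih => exact .cons (h ha) hx ih

/-- The multiset is that of the degrees of the factors. The last clause turns "no factor" into `u =
1`, once `sum_ne_zero` has excluded nonempty sums. -/
theorem IsMonomial.exists_multiset {W : V → Submodule k L} {S : Set V} {ν : V}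
    {u : UniversalEnvelopingAlgebra k L} (hu : IsMonomial W S ν u) :
    ∃ s : Multiset V, (∀ a ∈ s, a ∈ S) ∧ s.sum = ν ∧ (s = 0 → u = 1) := by
  induction hu with
  | one => exact ⟨0, by simp, rfl, fun _ => rfl⟩
  | @cons a ν x u ha hx _ ih =>
    obtain ⟨s, hs, h1, h2⟩ := ih
    refine ⟨a ::ₘ s, ?_, by rw [Multiset.sum_cons, h1], fun h => absurd h Multiset.cons_ne_zero⟩
    intro c hc
    rcases Multiset.mem_cons.1 hc with rfl | hc
    exacts [ha, hs c hc]

variable {W : V → Submodule k L} {T : Set V}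

/-- A nonempty product has its last factor in `L_S`; `eq_one_or_exists` looks at the first factor
instead. -/
theorem IsMonomial.eq_one_or_mem_leftSpan {S : Set V} {ν : V}
    {u : UniversalEnvelopingAlgebra k L} (hu : IsMonomial W S ν u) :
    u = 1 ∧ ν = 0 ∨ u ∈ leftSpan W S := by
  induction hu with
  | one => exact Or.inl ⟨rfl, rfl⟩
  | @cons a ν x u ha hx _ ih =>
    right
    rcases ih with ⟨rfl, -⟩ | h
    · rw [mul_one]
      exact Submodule.subset_span ⟨x, le_partSum W ha hx, rfl⟩
    · exact Submodule.smul_mem _ _ h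

theorem IsMonomial.eq_one_or_exists {S : Set V} {ν : V}
    {u : UniversalEnvelopingAlgebra k L} (hu : IsMonomial W S ν u) :
    u = 1 ∧ ν = 0 ∨ ∃ a ∈ S, ∃ x ∈ W a, ∃ v, u = ι x * v := by
  cases hu with
  | one => exact Or.inl ⟨rfl, rfl⟩
  | cons ha hx _ => exact Or.inr ⟨_, ha, _, hx, _, rfl⟩

/-- The span of the products of negative, neutral and positive elements, in this order, of total
degree `ν`. -/
def triangularSpan (W : V → Submodule k L) (T : Set V) (L₀ : LieSubalgebra k L) (ν : V) :
    Submodule k (UniversalEnvelopingAlgebra k L) :=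
  Submodule.span k {u | ∃ ν₁ ν₂ y z x, IsMonomial W {a | -a ∈ T} ν₁ y ∧ IsMonomial W T ν₂ x ∧
    ν₁ + ν₂ = ν ∧ u = y * (envMap L₀ z * x)}

theorem ι_mul_mem_triangularSpan_of_neg {L₀ : LieSubalgebra k L} {a ν : V} {t : L}
    {u : UniversalEnvelopingAlgebra k L} (ha : -a ∈ T) (ht : t ∈ W a)
    (hu : u ∈ triangularSpan W T L₀ ν) : ι t * u ∈ triangularSpan W T L₀ (a + ν) := by
  induction hu using Submodule.span_induction with
  | mem u hu =>
    obtain ⟨ν₁, ν₂, y, z, x, hy, hx, rfl, rfl⟩ := hu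
    refine Submodule.subset_span ⟨a + ν₁, ν₂, ι t * y, z, x, .cons ha ht hy, hx, ?_, ?_⟩
    · rw [add_assoc]
    · rw [mul_assoc]
  | zero => rw [mul_zero]; exact zero_mem _
  | add u v _ _ hu hv => rw [mul_add]; exact add_mem hu hv
  | smul c u _ hu => rw [mul_smul_comm]; exact Submodule.smul_mem _ _ hu

theorem one_mem_triangularSpan {L₀ : LieSubalgebra k L} :
    (1 : UniversalEnvelopingAlgebra k L) ∈ triangularSpan W T L₀ 0 :=
  Submodule.subset_span ⟨0, 0, 1, 1, 1, .one, .one, add_zero 0, by rw [map_one, one_mul, one_mul]⟩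

namespace IsTriangularGrading

variable (hW : IsTriangularGrading W T) {L₀ : LieSubalgebra k L}
include hW

/-- Commuting `t` past an element of `L₀` produces a bracket that is again in `W a`. -/
theorem ι_mul_envMap_mem (h₀ : L₀.toSubmodule = W 0) {a : V}
    (z : UniversalEnvelopingAlgebra k L₀) : ∀ t ∈ W a, ι t * envMap L₀ z ∈
      Submodule.span k {u | ∃ z' : UniversalEnvelopingAlgebra k L₀, ∃ t' ∈ W a,
        u = envMap L₀ z' * ι t'} := by
  induction z using enveloping_induction with
  | one =>
    intro t ht
    refine Submodule.subset_span ⟨1, t, ht, ?_⟩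
    rw [map_one, one_mul, mul_one]
  | add z₁ z₂ h₁ h₂ =>
    intro t ht
    rw [map_add, mul_add]
    exact add_mem (h₁ t ht) (h₂ t ht)
  | smul c z h =>
    intro t ht
    rw [map_smul, mul_smul_comm]
    exact Submodule.smul_mem _ _ (h t ht)
  | ι_mul c z h =>
    intro t ht
    have hc : (c : L) ∈ W 0 := by rw [← h₀]; exact c.2
    rw [map_mul, envMap_ι, ← mul_assoc, ι_mul_ι, add_mul, mul_assoc]
    refine add_mem ?_ (h _ ?_)
    · have key := h t ht
      generalize ι t * envMap L₀ z = w at key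
      induction key using Submodule.span_induction with
      | mem u hu =>
        obtain ⟨z', t', ht', rfl⟩ := hu
        refine Submodule.subset_span ⟨UniversalEnvelopingAlgebra.ι k c * z', t', ht', ?_⟩
        rw [map_mul, envMap_ι, mul_assoc]
      | zero => rw [mul_zero]; exact zero_mem _
      | add u v _ _ hu hv => rw [mul_add]; exact add_mem hu hv
      | smul c u _ hu => rw [mul_smul_comm]; exact Submodule.smul_mem _ _ hu
    · have := hW.lie_mem ht hc
      rwa [add_zero] at this

/-- Induction on the length of the negative part `y`. Moving `t` past its first factor `s` leaves
`[t, s]` in front of a shorter negative part. This bracket may have any degree, so the statement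
quantifies over all `a` and `t`. -/
theorem ι_mul_mem_triangularSpan_aux (h₀ : L₀.toSubmodule = W 0) {ν₁ ν₂ : V}
    {y x : UniversalEnvelopingAlgebra k L} (hy : IsMonomial W {a | -a ∈ T} ν₁ y)
    (hx : IsMonomial W T ν₂ x) (z : UniversalEnvelopingAlgebra k L₀) :
    ∀ a, ∀ t ∈ W a, ι t * (y * (envMap L₀ z * x)) ∈ triangularSpan W T L₀ (a + (ν₁ + ν₂)) := by
  induction hy with
  | one =>
    intro a t ht
    rw [one_mul, zero_add]
    by_cases ha0 : a = 0
    · subst ha0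
      have ht' : t ∈ L₀ := by rw [← h₀] at ht; exact ht
      refine Submodule.subset_span ⟨0, ν₂, 1, UniversalEnvelopingAlgebra.ι k ⟨t, ht'⟩ * z, x, .one,
        hx, rfl, ?_⟩
      rw [map_mul, envMap_ι, one_mul, mul_assoc]
    by_cases haT : a ∈ T
    · have key := hW.ι_mul_envMap_mem h₀ z t ht
      rw [← mul_assoc]
      generalize ι t * envMap L₀ z = w at key
      induction key using Submodule.span_induction with
      | mem u hu =>
        obtain ⟨z', t', ht', rfl⟩ := hu
        refine Submodule.subset_span ⟨0, a + ν₂, 1, z', ι t' * x, .one, .cons haT ht' hx,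
          zero_add _, ?_⟩
        rw [one_mul, mul_assoc]
      | zero => rw [zero_mul]; exact zero_mem _
      | add u v _ _ hu hv => rw [add_mul]; exact add_mem hu hv
      | smul c u _ hu => rw [smul_mul_assoc]; exact Submodule.smul_mem _ _ hu
    by_cases haN : -a ∈ T
    · have := IsMonomial.cons (S := {a | -a ∈ T}) haN ht .one
      refine Submodule.subset_span ⟨a + 0, ν₂, ι t * 1, z, x, this, hx, by rw [add_zero], ?_⟩
      rw [mul_one]
    · rw [hW.eq_bot a ha0 haT haN, Submodule.mem_bot] at ht
      rw [ht, map_zero, zero_mul]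
      exact zero_mem _
  | @cons b ν₁ s y' hb hs hy' ih =>
    intro a t ht
    rw [mul_assoc, ← mul_assoc, ι_mul_ι, add_mul, mul_assoc]
    refine add_mem ?_ ?_
    · have := ι_mul_mem_triangularSpan_of_neg hb hs (ih a t ht)
      rwa [show b + (a + (ν₁ + ν₂)) = a + (b + ν₁ + ν₂) by abel] at this
    · have := ih _ _ (hW.lie_mem ht hs)
      rwa [show a + b + (ν₁ + ν₂) = a + (b + ν₁ + ν₂) by abel] at this

theorem ι_mul_mem_triangularSpan (h₀ : L₀.toSubmodule = W 0) {a ν : V} {t : L} (ht : t ∈ W a)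
    {u : UniversalEnvelopingAlgebra k L} (hu : u ∈ triangularSpan W T L₀ ν) :
    ι t * u ∈ triangularSpan W T L₀ (a + ν) := by
  induction hu using Submodule.span_induction with
  | mem u hu =>
    obtain ⟨ν₁, ν₂, y, z, x, hy, hx, rfl, rfl⟩ := hu
    exact hW.ι_mul_mem_triangularSpan_aux h₀ hy hx z a t ht
  | zero => rw [mul_zero]; exact zero_mem _
  | add u v _ _ hu hv => rw [mul_add]; exact add_mem hu hv
  | smul c u _ hu => rw [mul_smul_comm]; exact Submodule.smul_mem _ _ hu

theorem mem_triangularSpan (h₀ : L₀.toSubmodule = W 0) {ν : V}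
    {u : UniversalEnvelopingAlgebra k L} (hu : IsMonomial W Set.univ ν u) :
    u ∈ triangularSpan W T L₀ ν := by
  induction hu with
  | one => exact one_mem_triangularSpan
  | cons _ hx _ ih => exact hW.ι_mul_mem_triangularSpan h₀ hx ih

theorem mem_iSup_triangularSpan (h₀ : L₀.toSubmodule = W 0) (u : UniversalEnvelopingAlgebra k L) :
    u ∈ ⨆ ν, triangularSpan W T L₀ ν := by
  induction u using enveloping_induction with
  | one => exact Submodule.mem_iSup_of_mem 0 one_mem_triangularSpan
  | add _ _ ha hb => exact add_mem ha hb
  | smul c _ ha => exact Submodule.smul_mem _ c ha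
  | ι_mul x u hu =>
    have hx : x ∈ ⨆ a, W a := by rw [hW.iSup_eq_top]; trivial
    induction hx using Submodule.iSup_induction' with
    | zero => rw [map_zero, zero_mul]; exact zero_mem _
    | add x y _ _ hx hy => rw [map_add, add_mul]; exact add_mem hx hy
    | mem a x hx =>
      induction hu using Submodule.iSup_induction' with
      | zero => rw [mul_zero]; exact zero_mem _
      | add u v _ _ hu hv => rw [mul_add]; exact add_mem hu hv
      | mem ν u hu =>
        exact Submodule.mem_iSup_of_mem _ (hW.ι_mul_mem_triangularSpan h₀ hx hu)

/-- Induction on triangular monomials. -/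
theorem triangular_induction (h₀ : L₀.toSubmodule = W 0)
    {p : UniversalEnvelopingAlgebra k L → Prop} (zero : p 0) (add : ∀ a b, p a → p b → p (a + b))
    (smul : ∀ (c : k) a, p a → p (c • a))
    (mem : ∀ ν₁ ν₂ y z x, IsMonomial W {a | -a ∈ T} ν₁ y → IsMonomial W T ν₂ x →
      p (y * (envMap L₀ z * x))) (u : UniversalEnvelopingAlgebra k L) : p u := by
  refine Submodule.iSup_induction _ (motive := p) (hW.mem_iSup_triangularSpan h₀ u)
    (fun ν u hu => ?_) zero add
  induction hu using Submodule.span_induction with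
  | mem u hu =>
    obtain ⟨ν₁, ν₂, y, z, x, hy, hx, -, rfl⟩ := hu
    exact mem _ _ _ _ _ hy hx
  | zero => exact zero
  | add u v _ _ hu hv => exact add _ _ hu hv
  | smul c u _ hu => exact smul _ _ hu

theorem zero_notMem : (0 : V) ∉ T := fun h =>
  hW.sum_ne_zero {0} (Multiset.singleton_ne_zero _) (by simpa using h) (by simp)

theorem neg_notMem {a : V} (ha : a ∈ T) : -a ∉ T := fun h =>
  hW.sum_ne_zero {a, -a} (Multiset.cons_ne_zero)
    (by intro b hb; simp only [Multiset.insert_eq_cons, Multiset.mem_cons,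
          Multiset.mem_singleton] at hb; rcases hb with rfl | rfl <;> assumption)
    (by simp)

theorem add_ne_zero {a b : V} (ha : a ∈ T) (hb : b ∈ T) : a + b ≠ 0 := fun h =>
  hW.neg_notMem ha (by rwa [neg_eq_of_add_eq_zero_right h])

theorem neg_add_notMem {a b : V} (ha : a ∈ T) (hb : b ∈ T) : -(a + b) ∉ T := fun h =>
  hW.sum_ne_zero {a, b, -(a + b)} (Multiset.cons_ne_zero)
    (by intro c hc; simp only [Multiset.insert_eq_cons, Multiset.mem_cons,
          Multiset.mem_singleton] at hc; rcases hc with rfl | rfl | rfl <;> assumption)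
    (by simp)

theorem lie_mem_partSum_of_forall {S₁ S₂ S₃ : Set V}
    (h : ∀ a ∈ S₁, ∀ b ∈ S₂, W (a + b) ≤ partSum W S₃) {x y : L} (hx : x ∈ partSum W S₁)
    (hy : y ∈ partSum W S₂) : ⁅x, y⁆ ∈ partSum W S₃ := by
  refine partSum_induction W (p := fun x => ⁅x, y⁆ ∈ partSum W S₃) hx (fun a ha x hx => ?_) ?_
    fun x x' hx hx' => ?_
  · refine partSum_induction W (p := fun y => ⁅x, y⁆ ∈ partSum W S₃) hy (fun b hb y hy => ?_) ?_
      fun y y' hy hy' => ?_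
    · exact h a ha b hb (hW.lie_mem hx hy)
    · rw [lie_zero]; exact zero_mem _
    · rw [lie_add]; exact add_mem hy hy'
  · rw [zero_lie]; exact zero_mem _
  · rw [add_lie]; exact add_mem hx hx'

/-- If `a + b ∉ T`, it is not in `{0} ∪ -T` either, since no nonempty sum over `T` vanishes; so its
component is zero. -/
theorem component_add_le {a b : V} (ha : a ∈ T) (hb : b ∈ T) : W (a + b) ≤ partSum W T := by
  by_cases h : a + b ∈ T
  · exact le_partSum W h
  · rw [hW.eq_bot _ (hW.add_ne_zero ha hb) h (hW.neg_add_notMem ha hb)]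
    exact bot_le

theorem component_add_le_of_neg {a b : V} (ha : -a ∈ T) (hb : -b ∈ T) :
    W (a + b) ≤ partSum W {a | -a ∈ T} := by
  have e : -(a + b) = -a + -b := by abel
  by_cases h : -(a + b) ∈ T
  · exact le_partSum W h
  · rw [hW.eq_bot (a + b) _ _ h]
    · exact bot_le
    · intro h0
      exact hW.add_ne_zero ha hb (by rw [← e, h0, neg_zero])
    · intro h0
      refine hW.neg_add_notMem ha hb ?_
      rwa [← e, neg_neg]

/-- The subalgebra `L₊`. -/
def posAlg : LieSubalgebra k L where
  __ := partSum W T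
  lie_mem' hx hy := hW.lie_mem_partSum_of_forall
    (fun _ ha _ hb => hW.component_add_le ha hb) hx hy

/-- The subalgebra `L₋ ⊕ L₀`. -/
def nonposAlg : LieSubalgebra k L where
  __ := partSum W {a | a = 0 ∨ -a ∈ T}
  lie_mem' hx hy := by
    refine hW.lie_mem_partSum_of_forall (fun a ha b hb => ?_) hx hy
    rcases ha with rfl | ha
    · rw [zero_add]; exact le_partSum W hb
    · rcases hb with rfl | hb
      · rw [add_zero]; exact le_partSum W (Or.inr ha)
      · exact (hW.component_add_le_of_neg ha hb).trans
          (biSup_mono fun c hc => Or.inr hc)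

theorem isCompl_partSum {S S' : Set V} (hd : Disjoint S S')
    (hu : ∀ a, W a ≠ ⊥ → a ∈ S ∨ a ∈ S') : IsCompl (partSum W S) (partSum W S') := by
  refine ⟨hW.indep.disjoint_biSup_biSup hd, codisjoint_iff_le_sup.2 ?_⟩
  rw [← hW.iSup_eq_top]
  refine iSup_le fun a => ?_
  by_cases ha : W a = ⊥
  · rw [ha]; exact bot_le
  · rcases hu a ha with h | h
    · exact (le_partSum W h).trans le_sup_left
    · exact (le_partSum W h).trans le_sup_right

theorem isCompl_nonposAlg_posAlg :
    IsCompl hW.nonposAlg.toSubmodule hW.posAlg.toSubmodule := by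
  refine hW.isCompl_partSum (S := {a | a = 0 ∨ -a ∈ T}) (S' := T) ?_ ?_
  · rw [Set.disjoint_left]
    rintro a (rfl | ha) h
    · exact hW.zero_notMem h
    · exact hW.neg_notMem h ha
  · intro a ha
    by_contra! h
    exact ha (hW.eq_bot a (fun h0 => h.1 (Or.inl h0)) h.2 (fun h0 => h.1 (Or.inr h0)))

theorem isCompl_zero_ne_zero : IsCompl (partSum W {0}) (partSum W {a | a ≠ 0}) := by
  refine hW.isCompl_partSum ?_ fun a _ => ?_
  · rw [Set.disjoint_left]
    rintro a rfl h
    exact h rfl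
  · exact em (a = 0)

end IsTriangularGrading

end TriangularGrading

/-! ### The Harish-Chandra projection on all of `U(L)`. -/

section HarishChandra

variable {k L V : Type*} [Field k] [LieRing L] [LieAlgebra k L] [AddCommGroup V]

local notation "ι" => UniversalEnvelopingAlgebra.ι k

variable {W : V → Submodule k L} {T : Set V} {L₀ : LieSubalgebra k L}

namespace IsTriangularGrading

variable (hW : IsTriangularGrading W T) (h₀ : L₀.toSubmodule = W 0)

theorem isCompl_degreeZero (hW : IsTriangularGrading W T) (h₀ : L₀.toSubmodule = W 0) :
    IsCompl L₀.toSubmodule (partSum W {a | a ≠ 0}) := by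
  have := hW.isCompl_zero_ne_zero
  have e : partSum W {0} = W 0 := by simp [partSum]
  rwa [e, ← h₀] at this

/-- The projection of `L` onto its component of degree zero. -/
noncomputable def zeroProj : L →ₗ[k] L₀ :=
  L₀.toSubmodule.projectionOnto (partSum W {a | a ≠ 0}) (hW.isCompl_degreeZero h₀)

theorem zeroProj_coe (x : L₀) : hW.zeroProj h₀ (x : L) = x :=
  Submodule.projectionOnto_apply_left _ x

theorem zeroProj_of_ne_zero {a : V} (ha : a ≠ 0) {x : L} (hx : x ∈ W a) :
    hW.zeroProj h₀ x = 0 :=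
  Submodule.projectionOnto_apply_of_mem_right _ (le_partSum W (S := {a | a ≠ 0}) ha hx)

/-- `L₋` is an ideal of `L₋ ⊕ L₀`: adding a negative degree to a nonpositive one never gives zero.
-/
theorem zeroProj_lie {x y : L} (hx : x ∈ hW.nonposAlg) (hy : y ∈ hW.nonposAlg) :
    hW.zeroProj h₀ ⁅x, y⁆ = ⁅hW.zeroProj h₀ x, hW.zeroProj h₀ y⁆ := by
  have hne : ∀ {a : V}, -a ∈ T → a ≠ 0 := by
    rintro a ha rfl
    exact hW.zero_notMem (by rwa [neg_zero] at ha)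
  refine partSum_induction W (S := {a | a = 0 ∨ -a ∈ T})
    (p := fun x => hW.zeroProj h₀ ⁅x, y⁆ = ⁅hW.zeroProj h₀ x, hW.zeroProj h₀ y⁆) hx
    (fun a ha x hx => ?_) ?_ fun x x' hx hx' => ?_
  · refine partSum_induction W (S := {a | a = 0 ∨ -a ∈ T})
      (p := fun y => hW.zeroProj h₀ ⁅x, y⁆ = ⁅hW.zeroProj h₀ x, hW.zeroProj h₀ y⁆) hy
      (fun b hb y hy => ?_) ?_ fun y y' hy hy' => ?_
    · have hxy := hW.lie_mem hx hy
      rcases ha with rfl | ha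
      · rcases hb with rfl | hb
        · rw [← h₀] at hx hy
          have h1 := hW.zeroProj_coe h₀ ⟨x, hx⟩
          have h2 := hW.zeroProj_coe h₀ ⟨y, hy⟩
          have h3 := hW.zeroProj_coe h₀ ⁅(⟨x, hx⟩ : L₀), (⟨y, hy⟩ : L₀)⁆
          rw [LieSubalgebra.coe_bracket] at h3
          dsimp only at h1 h2 h3
          rw [h1, h2, h3]
        · rw [zero_add] at hxy
          rw [hW.zeroProj_of_ne_zero h₀ (hne hb) hxy, hW.zeroProj_of_ne_zero h₀ (hne hb) hy,
            lie_zero]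
      · rw [hW.zeroProj_of_ne_zero h₀ (hne ha) hx, zero_lie]
        refine hW.zeroProj_of_ne_zero h₀ ?_ hxy
        rcases hb with rfl | hb
        · rw [add_zero]; exact hne ha
        · intro h
          exact hW.add_ne_zero ha hb (by rw [← neg_zero, ← h]; abel)
    · rw [lie_zero, map_zero, lie_zero]
    · rw [lie_add, map_add, map_add, lie_add, hy, hy']
  · rw [zero_lie, map_zero, zero_lie]
  · rw [add_lie, map_add, map_add, add_lie, hx, hx']

/-- The homomorphism `L₋ ⊕ L₀ → L₀` with kernel `L₋`. -/
noncomputable def nonposHom : hW.nonposAlg →ₗ⁅k⁆ L₀ where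
  __ := hW.zeroProj h₀ ∘ₗ hW.nonposAlg.toSubmodule.subtype
  map_lie' {x y} := hW.zeroProj_lie h₀ x.2 y.2

/-- The projection `U(L) → U(L₀)` with kernel `L₋ U(L) + U(L) L₊`. -/
noncomputable def hcProj : UniversalEnvelopingAlgebra k L →ₗ[k] UniversalEnvelopingAlgebra k L₀ :=
  (UniversalEnvelopingAlgebra.lift k
    ((UniversalEnvelopingAlgebra.ι k).comp (hW.nonposHom h₀))).toLinearMap ∘ₗ
    envProj hW.isCompl_nonposAlg_posAlg

theorem hcProj_one : hW.hcProj h₀ 1 = 1 := by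
  change UniversalEnvelopingAlgebra.lift k _ (envProj hW.isCompl_nonposAlg_posAlg 1) = 1
  rw [envProj_one, map_one]

theorem hcProj_ι_mul {x : L} (hx : x ∈ hW.nonposAlg) (u : UniversalEnvelopingAlgebra k L) :
    hW.hcProj h₀ (ι x * u) = ι (hW.zeroProj h₀ x) * hW.hcProj h₀ u := by
  change UniversalEnvelopingAlgebra.lift k _
    (envProj hW.isCompl_nonposAlg_posAlg (ι ((⟨x, hx⟩ : hW.nonposAlg) : L) * u)) = _
  rw [envProj_ι_mul, map_mul, UniversalEnvelopingAlgebra.lift_ι_apply]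
  rfl

theorem hcProj_ι_mul_of_neg {a : V} (ha : -a ∈ T) {x : L} (hx : x ∈ W a)
    (u : UniversalEnvelopingAlgebra k L) : hW.hcProj h₀ (ι x * u) = 0 := by
  have ha0 : a ≠ 0 := by
    rintro rfl
    exact hW.zero_notMem (by rwa [neg_zero] at ha)
  rw [hcProj_ι_mul, hW.zeroProj_of_ne_zero h₀ ha0 hx, map_zero, zero_mul]
  exact le_partSum W (S := {a | a = 0 ∨ -a ∈ T}) (Or.inr ha) hx

theorem hcProj_envMap_mul (z : UniversalEnvelopingAlgebra k L₀)
    (u : UniversalEnvelopingAlgebra k L) :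
    hW.hcProj h₀ (envMap L₀ z * u) = z * hW.hcProj h₀ u := by
  induction z using enveloping_induction with
  | one => rw [map_one, one_mul, one_mul]
  | add a b ha hb => rw [map_add, add_mul, map_add, ha, hb, add_mul]
  | smul c a ha => rw [map_smul, smul_mul_assoc, map_smul, ha, smul_mul_assoc]
  | ι_mul x a ha =>
    rw [map_mul (envMap L₀), envMap_ι, mul_assoc, hcProj_ι_mul, ha, mul_assoc, zeroProj_coe]
    refine le_partSum W (S := {a | a = 0 ∨ -a ∈ T}) (a := 0) (Or.inl rfl) ?_
    rw [← h₀]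
    exact x.2

theorem hcProj_envMap (z : UniversalEnvelopingAlgebra k L₀) :
    hW.hcProj h₀ (envMap L₀ z) = z := by
  have := hW.hcProj_envMap_mul h₀ z 1
  rwa [mul_one, hcProj_one, mul_one] at this

theorem hcProj_of_mem_leftSpan {u : UniversalEnvelopingAlgebra k L} (hu : u ∈ leftSpan W T) :
    hW.hcProj h₀ u = 0 := by
  induction hu using Submodule.span_induction with
  | zero => exact map_zero _
  | add u v _ _ hu hv => rw [map_add, hu, hv, add_zero]
  | mem u hu =>
    obtain ⟨x, hx, rfl⟩ := hu
    have h := envProj_mul_ι hW.isCompl_nonposAlg_posAlg 1 ⟨x, hx⟩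
    rw [one_mul] at h
    change UniversalEnvelopingAlgebra.lift k _ (envProj _ (ι x)) = 0
    rw [h, map_zero]
  | smul v u hu _ =>
    -- The outer hypothesis says nothing about `v * u`, so a fresh induction is run with the left
    -- factor `v` arbitrary.
    clear * - hu
    rw [smul_eq_mul]
    induction hu using Submodule.span_induction generalizing v with
    | zero => rw [mul_zero]; exact map_zero _
    | add u u' _ _ hu hu' => rw [mul_add, map_add, hu, hu', add_zero]
    | mem u hu =>
      obtain ⟨x, hx, rfl⟩ := hu
      have h := envProj_mul_ι hW.isCompl_nonposAlg_posAlg v ⟨x, hx⟩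
      change UniversalEnvelopingAlgebra.lift k _ (envProj _ (v * ι x)) = 0
      rw [h, map_zero]
    | smul w u _ hu =>
      rw [smul_eq_mul, ← mul_assoc]
      exact hu (v * w)

/-- The Harish-Chandra decomposition: an element of degree zero lies in `U(L₀) + U(L) L₊`. -/
theorem sub_envMap_hcProj_mem {u : UniversalEnvelopingAlgebra k L}
    (hu : u ∈ triangularSpan W T L₀ 0) : u - envMap L₀ (hW.hcProj h₀ u) ∈ leftSpan W T := by
  induction hu using Submodule.span_induction with
  | mem u hu =>
    obtain ⟨ν₁, ν₂, y, z, x, hy, hx, hν, rfl⟩ := hu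
    rcases hx.eq_one_or_mem_leftSpan with ⟨rfl, rfl⟩ | hx'
    · obtain ⟨s, hs, hsum, hs0⟩ := hy.exists_multiset
      -- Without a positive part, `y` alone has degree zero; a nonempty `y` would give a vanishing
      -- sum over `T`.
      have hs' : s = 0 := by
        by_contra h
        refine hW.sum_ne_zero (s.map fun a => -a) (by simpa using h) ?_ ?_
        · intro a ha
          obtain ⟨b, hb, rfl⟩ := Multiset.mem_map.1 ha
          exact hs b hb
        · rw [Multiset.sum_map_neg, Multiset.map_id', hsum, ← add_zero ν₁, hν, neg_zero]
      rw [hs0 hs', one_mul, mul_one, hcProj_envMap, sub_self]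
      exact zero_mem _
    · have : y * (envMap L₀ z * x) ∈ leftSpan W T :=
        Submodule.smul_mem _ _ (Submodule.smul_mem _ _ hx')
      rw [hW.hcProj_of_mem_leftSpan h₀ this, map_zero, sub_zero]
      exact this
  | zero => rw [map_zero, map_zero, sub_zero]; exact zero_mem _
  | add u v _ _ hu hv =>
    rw [map_add, map_add, add_sub_add_comm]
    exact add_mem hu hv
  | smul c u _ hu =>
    rw [map_smul, map_smul, ← smul_sub, ← algebraMap_smul (UniversalEnvelopingAlgebra k L) c]
    exact Submodule.smul_mem _ _ hu

/-- A triangular monomial of nonzero degree begins with a factor from `L₋` or ends with one from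
`L₊`, and both kinds are killed. -/
theorem hcProj_eq_zero_of_ne_zero {ν : V} (hν : ν ≠ 0) {u : UniversalEnvelopingAlgebra k L}
    (hu : u ∈ triangularSpan W T L₀ ν) : hW.hcProj h₀ u = 0 := by
  induction hu using Submodule.span_induction with
  | mem u hu =>
    obtain ⟨ν₁, ν₂, y, z, x, hy, hx, rfl, rfl⟩ := hu
    rcases hx.eq_one_or_mem_leftSpan with ⟨rfl, rfl⟩ | hx'
    · rcases hy.eq_one_or_exists with ⟨rfl, rfl⟩ | ⟨a, ha, t, ht, v, rfl⟩
      · exact absurd (add_zero 0) hν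
      · rw [mul_assoc]
        exact hW.hcProj_ι_mul_of_neg h₀ ha ht _
    · exact hW.hcProj_of_mem_leftSpan h₀
        (Submodule.smul_mem _ _ (Submodule.smul_mem _ _ hx'))
  | zero => exact map_zero _
  | add u v _ _ hu hv => rw [map_add, hu, hv, add_zero]
  | smul c u _ hu => rw [map_smul, hu, smul_zero]

/-- The image of a left ideal of `U(L)` under the projection to `U(L₀)`. -/
theorem hcProj_mem_of_mem_span {J : Ideal (UniversalEnvelopingAlgebra k L₀)}
    {G : Set (UniversalEnvelopingAlgebra k L)}
    (h : ∀ g ∈ G, ∀ ν x, IsMonomial W T ν x → hW.hcProj h₀ (x * g) ∈ J)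
    {u : UniversalEnvelopingAlgebra k L} (hu : u ∈ Ideal.span G) : hW.hcProj h₀ u ∈ J := by
  suffices ∀ v : UniversalEnvelopingAlgebra k L, hW.hcProj h₀ (v * u) ∈ J by
    simpa using this 1
  induction hu using Submodule.span_induction with
  | mem g hg =>
    intro v
    induction v using hW.triangular_induction h₀ with
    | zero => rw [zero_mul, map_zero]; exact J.zero_mem
    | add a b ha hb => rw [add_mul, map_add]; exact J.add_mem ha hb
    | smul c a ha =>
      rw [smul_mul_assoc, map_smul, ← algebraMap_smul (UniversalEnvelopingAlgebra k L₀) c]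
      exact J.smul_mem _ ha
    | mem ν₁ ν₂ y z x hy hx =>
      -- A negative factor in front gives zero. Otherwise `z` comes out on the left, and only the
      -- positive monomial `x` remains to be tested.
      rcases hy.eq_one_or_exists with ⟨rfl, rfl⟩ | ⟨a, ha, t, ht, v, rfl⟩
      · rw [one_mul, mul_assoc, hcProj_envMap_mul]
        exact J.mul_mem_left _ (h g hg _ _ hx)
      · rw [mul_assoc, mul_assoc, hW.hcProj_ι_mul_of_neg h₀ ha ht]
        exact J.zero_mem
  | zero => intro v; rw [mul_zero, map_zero]; exact J.zero_mem
  | add a b _ _ ha hb => intro v; rw [mul_add, map_add]; exact J.add_mem (ha v) (hb v)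
  | smul c a _ ha => intro v; rw [smul_eq_mul, ← mul_assoc]; exact ha (v * c)

end IsTriangularGrading

end HarishChandra

/-! ### Sums of positive roots. -/

section PositiveSystem

variable {k V N ι : Type*} [Field k] [CharZero k] [AddCommGroup V] [Module k V] [AddCommGroup N]
  [Module k N]

/-- If a nonempty sum of roots vanishes, then two of its terms enclose an obtuse angle. -/
theorem exists_pairingIn_neg_of_sum_eq_zero (P : RootPairing ι k V N) [P.IsCrystallographic]
    (i : ι) (s : Multiset ι) (h : P.root i + (s.map P.root).sum = 0) :
    ∃ j ∈ s, P.pairingIn ℤ j i < 0 := by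
  by_contra! hs
  -- Pairing with the coroot of `i` gives `2 + ∑ = 0`, so some summand is negative.
  have h1 : P.toLinearMap.flip (P.coroot i) (P.root i + (s.map P.root).sum) = 0 := by
    rw [h, map_zero]
  rw [map_add, map_multiset_sum, Multiset.map_map] at h1
  have h2 : (s.map (P.toLinearMap.flip (P.coroot i) ∘ P.root))
      = (s.map fun j => P.pairingIn ℤ j i).map (Int.castRingHom k) := by
    rw [Multiset.map_map]
    refine Multiset.map_congr rfl fun j _ => ?_
    exact (P.algebraMap_pairingIn ℤ j i).symm
  have h3 : P.toLinearMap.flip (P.coroot i) (P.root i) = ((2 : ℤ) : k) := by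
    simp
  rw [h2, ← map_multiset_sum, h3, eq_intCast, ← Int.cast_add, Int.cast_eq_zero] at h1
  have : 0 ≤ (s.map fun j => P.pairingIn ℤ j i).sum := by
    refine Multiset.sum_nonneg fun a ha => ?_
    obtain ⟨j, hj, rfl⟩ := Multiset.mem_map.1 ha
    exact hs j hj
  omega

/-- In a vanishing sum two terms enclose an obtuse angle. They are not opposite, so their sum is a
root, again in `T`; merging them gives a shorter vanishing sum. -/
theorem IsPositiveSystem.sum_ne_zero [Finite ι] {P : RootPairing ι k V N} [P.IsCrystallographic] {T : Set V}
    (hT : IsPositiveSystem (roots P) T) (s : Multiset V) (hs : s ≠ 0) (hsT : ∀ a ∈ s, a ∈ T) :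
    s.sum ≠ 0 := by
  have hTr : T ⊆ roots P := by rw [hT.eq_union]; exact Set.subset_union_left
  induction hn : s.card using Nat.strong_induction_on generalizing s with
  | _ n ih =>
    subst hn
    intro h0
    obtain ⟨a, t, rfl⟩ : ∃ a t, s = a ::ₘ t := by
      obtain ⟨a, ha⟩ := Multiset.exists_mem_of_ne_zero hs
      exact ⟨a, _, (Multiset.exists_cons_of_mem ha).choose_spec⟩
    obtain ⟨i, rfl⟩ := hTr (hsT a (Multiset.mem_cons_self a t))
    obtain ⟨t', rfl⟩ : ∃ t' : Multiset ι, t = t'.map P.root := by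
      refine ⟨t.attach.map fun x => (hTr (hsT x.1 (Multiset.mem_cons_of_mem x.2))).choose, ?_⟩
      rw [Multiset.map_map]
      conv_lhs => rw [← Multiset.attach_map_val t]
      exact Multiset.map_congr rfl fun x _ =>
        (hTr (hsT x.1 (Multiset.mem_cons_of_mem x.2))).choose_spec.symm
    rw [Multiset.sum_cons] at h0
    obtain ⟨j, hj, hneg⟩ := exists_pairingIn_neg_of_sum_eq_zero P i t' h0
    obtain ⟨r, rfl⟩ := Multiset.exists_cons_of_mem hj
    have hi : P.root i ∈ T := hsT _ (Multiset.mem_cons_self _ _)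
    have hj' : P.root j ∈ T := hsT _ (Multiset.mem_cons_of_mem (Multiset.mem_map_of_mem _ hj))
    have hne : P.root j ≠ -P.root i := by
      intro h
      exact hT.disjoint_neg _ hi (h ▸ hj')
    have hsum := hT.add_mem _ hj' _ hi (P.root_add_root_mem_of_pairingIn_neg hneg hne)
    refine ih _ ?_ ((P.root j + P.root i) ::ₘ r.map P.root) (Multiset.cons_ne_zero) ?_ rfl ?_
    · simp
    · intro c hc
      rcases Multiset.mem_cons.1 hc with rfl | hc
      · exact hsum
      · refine hsT c (Multiset.mem_cons_of_mem ?_)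
        rw [Multiset.map_cons]
        exact Multiset.mem_cons_of_mem hc
    · rw [Multiset.map_cons, Multiset.sum_cons] at h0
      rw [Multiset.sum_cons, ← h0]
      abel

end PositiveSystem

/-! ### Independence of weight spaces, and the triangular grading of `L`. -/

section Weights

theorem iSupIndep_iInf_eigenspace {k M X : Type*} [Field k] [AddCommGroup M] [Module k M]
    (ρ : X → Module.End k M) (hρ : ∀ x y, Commute (ρ x) (ρ y)) :
    iSupIndep fun χ : X → k => ⨅ x, (ρ x).eigenspace (χ x) := by
  have h := Module.End.independent_iInf_maxGenEigenspace_of_forall_mapsTo ρ fun x y φ =>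
    Module.End.mapsTo_maxGenEigenspace_of_comm (hρ y x) φ
  refine h.mono fun χ => iInf_mono fun x => ?_
  exact ((ρ x).genEigenspace (χ x)).monotone le_top

/-- A vector of a weight that does not occur among the weights of a spanning family vanishes. -/
theorem eq_zero_of_weight_notMem {k M X : Type*} [Field k] [AddCommGroup M] [Module k M]
    (ρ : X → Module.End k M) (hρ : ∀ x y, Commute (ρ x) (ρ y)) {Λ : Set (X → k)} {m : M}
    (hm : m ∈ Submodule.span k {v | ∃ χ ∈ Λ, ∀ x, ρ x v = χ x • v}) {χ : X → k} (hχ : χ ∉ Λ)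
    (h : ∀ x, ρ x m = χ x • m) : m = 0 := by
  have hind := (iSupIndep_iInf_eigenspace ρ hρ).disjoint_biSup hχ
  refine Submodule.disjoint_def.1 hind m ?_ ?_
  · exact (Submodule.mem_iInf _).2 fun x => Module.End.mem_eigenspace_iff.2 (h x)
  · refine Submodule.span_le.2 ?_ hm
    rintro v ⟨ψ, hψ, hv⟩
    refine Submodule.mem_iSup_of_mem ψ (Submodule.mem_iSup_of_mem hψ ?_)
    exact (Submodule.mem_iInf _).2 fun x => Module.End.mem_eigenspace_iff.2 (hv x)

section

variable {k L : Type*} [Field k] [LieRing L] [LieAlgebra k L] {g : LieSubalgebra k L}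

theorem lie_mem_wtSpace {H : LieSubalgebra k g} {μ ν : Module.Dual k H} {x y : L}
    (hx : x ∈ wtSpace H μ) (hy : y ∈ wtSpace H ν) : ⁅x, y⁆ ∈ wtSpace H (μ + ν) := by
  intro h
  rw [leibniz_lie, hx h, hy h, smul_lie, lie_smul, LinearMap.add_apply, add_smul]

end

variable {k L : Type*} [Field k] [CharZero k] [LieRing L] [LieAlgebra k L]
  {g : LieSubalgebra k L} [FiniteDimensional k g] [LieAlgebra.IsSemisimple k g]
  {H : LieSubalgebra k g} [H.IsCartanSubalgebra]

theorem lie_cartan_eq_zero (h h' : H) : ⁅((h : g) : L), ((h' : g) : L)⁆ = 0 := by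
  have h0 : ⁅h, h'⁆ = 0 := trivial_lie_zero H H h h'
  have h1 : ⁅((h : g) : L), ((h' : g) : L)⁆ = ((⁅h, h'⁆ : H) : g) := rfl
  rw [h1, h0]
  rfl

theorem iSupIndep_wtSpace : iSupIndep fun μ : Module.Dual k H => (wtSpace H μ : Submodule k L) := by
  have h1 := iSupIndep_iInf_eigenspace
    (fun h : H => (LieAlgebra.ad k L ((h : g) : L) : Module.End k L)) (fun h h' => by
      rw [commute_iff_lie_eq, ← LieHom.map_lie, lie_cartan_eq_zero, map_zero])
  have h2 := h1.comp (f := fun μ : Module.Dual k H => (μ : H → k)) DFunLike.coe_injective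
  convert h2 using 1
  funext μ
  ext x
  simp only [Function.comp, Submodule.mem_iInf, Module.End.mem_eigenspace_iff,
    LieAlgebra.ad_apply]
  rfl

variable [LieModule.IsTriangularizable k H g]

/-- The weight space decomposition of a root graded Lie algebra is a triangular grading. -/
theorem IsRootGraded.isTriangularGrading {N X : Type*} [AddCommGroup N] [Module k N] [Finite X]
    {P : RootPairing X k (Module.Dual k H) N} [P.IsCrystallographic] (hL : IsRootGraded H P)
    {T : Set (Module.Dual k H)} (hT : IsPositiveSystem (roots P) T) :
    IsTriangularGrading (wtSpace H : Module.Dual k H → Submodule k L) T where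
  lie_mem := lie_mem_wtSpace
  iSup_eq_top := by
    rw [eq_top_iff, ← hL.iSup_wtSpace]
    exact iSup₂_le fun a _ => le_iSup _ a
  indep := iSupIndep_wtSpace
  eq_bot a ha haT hna := by
    by_contra h
    -- The components of degree in `Θ ∪ {0}` already span `L`, so by independence no other component
    -- is nonzero.
    have := iSupIndep_wtSpace.mem_of_biSup_eq_top hL.iSup_wtSpace h
    rw [hT.eq_union] at this
    rcases this with (h | h) | h
    exacts [haT h, hna h, ha h]
  sum_ne_zero := hT.sum_ne_zero

end Weights

/-! ### Computations with `sl₂`-triples. -/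

section SlTwo

variable {k M : Type*} [Field k] [AddCommGroup M] [Module k M] {h e f : Module.End k M}

theorem h_pow_f (hhf : ∀ m, h (f m) = f (h m) - (2 : k) • f m) {μ : k} {v : M} (hv : h v = μ • v)
    (n : ℕ) : h ((f ^ n) v) = (μ - 2 * n) • (f ^ n) v := by
  induction n with
  | zero => simp [hv]
  | succ n ih =>
    rw [pow_succ', Module.End.mul_apply, hhf, ih, map_smul, ← sub_smul]
    congr 1
    push_cast
    ring

theorem e_pow_succ_f (hef : ∀ m, e (f m) = f (e m) + h m)
    (hhf : ∀ m, h (f m) = f (h m) - (2 : k) • f m) {μ : k} {v : M} (hv : h v = μ • v) (n : ℕ) :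
    e ((f ^ (n + 1)) v) = (f ^ (n + 1)) (e v) + ((n + 1) * (μ - n)) • (f ^ n) v := by
  induction n with
  | zero => simp [hef, hv]
  | succ n ih =>
    have h1 : f ((f ^ n) v) = (f ^ (n + 1)) v := by rw [pow_succ', Module.End.mul_apply]
    have h2 : f ((f ^ (n + 1)) (e v)) = (f ^ (n + 1 + 1)) (e v) := by
      rw [pow_succ' f (n + 1), Module.End.mul_apply]
    rw [pow_succ' f (n + 1), Module.End.mul_apply, hef, ih, h_pow_f hhf hv, map_add, map_smul, h1,
      h2, add_assoc, ← add_smul, ← pow_succ']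
    congr 2
    push_cast
    ring

/-- If `e` acts locally nilpotently, then `f ^ n` is injective on vectors of weight `n ∈ ℕ`. -/
theorem eq_zero_of_pow_f_eq_zero [CharZero k] (hef : ∀ m, e (f m) = f (e m) + h m)
    (hhf : ∀ m, h (f m) = f (h m) - (2 : k) • f m)
    (hhe : ∀ m, h (e m) = e (h m) + (2 : k) • e m) (a n : ℕ) (v : M) (hv : h v = (n : k) • v)
    (hea : (e ^ a) v = 0) (hfn : (f ^ n) v = 0) : v = 0 := by
  induction a generalizing n v with
  | zero => simpa using hea
  | succ a ih =>
    have hev : e v = 0 := by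
      -- `e v` has weight `n + 2` and is killed by `e ^ a`. It is also killed by `f ^ (n + 2)`: by
      -- `e_pow_succ_f`, since `f ^ n` and all higher powers of `f` kill `v`.
      refine ih (n + 2) (e v) ?_ ?_ ?_
      · rw [hhe, hv, map_smul, ← add_smul]
        push_cast
        rfl
      · rwa [← Module.End.mul_apply, ← pow_succ]
      · have h1 := e_pow_succ_f hef hhf hv (n + 1)
        have h2 : (f ^ (n + 1)) v = 0 := by
          rw [pow_succ', Module.End.mul_apply, hfn, map_zero]
        rw [pow_succ' f (n + 1), Module.End.mul_apply, h2, map_zero, map_zero, smul_zero,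
          add_zero] at h1
        rw [show n + 2 = n + 1 + 1 from rfl, pow_succ']
        exact h1.symm
    -- As `e v = 0`, one has `e f ^ (p + 1) v = (p + 1) (n - p) f ^ p v` with nonzero coefficient
    -- for `p < n`, so the exponent descends from `n` to `0`.
    have key : ∀ j ≤ n, (f ^ (n - j)) v = 0 := by
      intro j
      induction j with
      | zero => intro _; exact hfn
      | succ j ihj =>
        intro hj
        obtain ⟨p, rfl⟩ : ∃ p, n = p + (j + 1) := ⟨n - (j + 1), by omega⟩
        have h1 := ihj (by omega)
        rw [show p + (j + 1) - j = p + 1 by omega] at h1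
        rw [show p + (j + 1) - (j + 1) = p by omega]
        have h2 := e_pow_succ_f hef hhf hv p
        rw [h1, map_zero, hev, map_zero, zero_add] at h2
        refine (smul_eq_zero.1 h2.symm).resolve_left (mul_ne_zero (Nat.cast_add_one_ne_zero p) ?_)
        push_cast
        rw [add_sub_cancel_left]
        exact Nat.cast_add_one_ne_zero j
    simpa using key n le_rfl

end SlTwo

/-! ### Local nilpotency of root vectors on cyclic modules. -/

section LocallyNilpotent

theorem ι_smul_ι_smul {k L M : Type*} [Field k] [LieRing L] [LieAlgebra k L] [AddCommGroup M]
    [Module (UniversalEnvelopingAlgebra k L) M] (x y : L) (m : M) :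
    UniversalEnvelopingAlgebra.ι k x • UniversalEnvelopingAlgebra.ι k y • m
      = UniversalEnvelopingAlgebra.ι k y • UniversalEnvelopingAlgebra.ι k x • m
        + UniversalEnvelopingAlgebra.ι k ⁅x, y⁆ • m := by
  rw [← mul_smul, ← mul_smul, ← add_smul, ι_mul_ι]

variable {k L V M : Type*} [Field k] [LieRing L] [LieAlgebra k L] [AddCommGroup V]
  [AddCommGroup M] [Module k M] [Module (UniversalEnvelopingAlgebra k L) M]
  [IsScalarTower k (UniversalEnvelopingAlgebra k L) M]

local notation "ι" => UniversalEnvelopingAlgebra.ι k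

/-- The action of an element of `L` on a `U(L)`-module. -/
noncomputable def actEnd (k : Type*) {L : Type*} [Field k] [LieRing L]
    [LieAlgebra k L] (M : Type*) [AddCommGroup M] [Module k M]
    [Module (UniversalEnvelopingAlgebra k L) M]
    [IsScalarTower k (UniversalEnvelopingAlgebra k L) M] (x : L) : Module.End k M :=
  Algebra.lsmul k k M (UniversalEnvelopingAlgebra.ι k x)

theorem actEnd_apply (x : L) (m : M) : actEnd k M x m = ι x • m := rfl

theorem actEnd_pow_apply (x : L) (n : ℕ) (m : M) : (actEnd k M x ^ n) m = ι x ^ n • m := by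
  rw [actEnd, ← map_pow]; rfl

/-- The vectors annihilated by a power of `f`. -/
noncomputable def nilVectors (M : Type*) [AddCommGroup M] [Module k M]
    [Module (UniversalEnvelopingAlgebra k L) M]
    [IsScalarTower k (UniversalEnvelopingAlgebra k L) M] (f : L) : Submodule k M :=
  (actEnd k M f).maxGenEigenspace 0

theorem mem_nilVectors {f : L} {m : M} : m ∈ nilVectors (k := k) M f ↔ ∃ n, ι f ^ n • m = 0 := by
  unfold nilVectors
  rw [Module.End.mem_maxGenEigenspace]
  simp only [zero_smul, sub_zero, actEnd_pow_apply]

theorem mem_nilVectors_of_ι_smul {f : L} {m : M} (h : ι f • m ∈ nilVectors (k := k) M f) :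
    m ∈ nilVectors (k := k) M f := by
  obtain ⟨n, hn⟩ := mem_nilVectors.1 h
  refine mem_nilVectors.2 ⟨n + 1, ?_⟩
  rwa [pow_succ, mul_smul]

/-- Here `n` bounds the applications of `ad f` that `W a` survives. In `f x m = x (f m) + [f, x] m`,
the first term improves the exponent that kills `m`, the second lowers `n`; hence the nested
induction. -/
theorem ι_smul_mem_nilVectors {W : V → Submodule k L} {T : Set V} (hW : IsTriangularGrading W T)
    {α : V} {f : L} (hf : f ∈ W (-α)) (n : ℕ) :
    ∀ a, W (a - n • α) = ⊥ → ∀ x ∈ W a, ∀ m ∈ nilVectors (k := k) M f,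
      ι x • m ∈ nilVectors (k := k) M f := by
  induction n with
  | zero =>
    intro a ha x hx m _
    rw [zero_smul, sub_zero] at ha
    rw [ha, Submodule.mem_bot] at hx
    rw [hx, map_zero, zero_smul]
    exact zero_mem _
  | succ n ih =>
    intro a ha x hx m hm
    have hfx : ⁅f, x⁆ ∈ W (a - α) := by
      have := hW.lie_mem hf hx
      rwa [neg_add_eq_sub] at this
    have ha' : W (a - α - n • α) = ⊥ := by
      rw [← ha, succ_nsmul']
      congr 1
      abel
    obtain ⟨p, hp⟩ := mem_nilVectors.1 hm
    clear hm
    induction p generalizing m with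
    | zero =>
      rw [pow_zero, one_smul] at hp
      rw [hp, smul_zero]
      exact zero_mem _
    | succ p ihp =>
      refine mem_nilVectors_of_ι_smul ?_
      rw [ι_smul_ι_smul]
      refine add_mem (ihp _ ?_) (ih _ ha' _ hfx m (mem_nilVectors.2 ⟨_, hp⟩))
      rwa [← mul_smul, ← pow_succ]

/-- A vector `f` of nonzero degree acts locally nilpotently on a cyclic module if it acts
nilpotently on the generator. -/
theorem nilVectors_eq_top {W : V → Submodule k L} {T : Set V} (hW : IsTriangularGrading W T)
    {α : V} {f : L} (hf : f ∈ W (-α)) (hα : ∀ a, ∃ n : ℕ, W (a - n • α) = ⊥) {w : M}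
    (hw : w ∈ nilVectors (k := k) M f)
    (hgen : ∀ m : M, ∃ u : UniversalEnvelopingAlgebra k L, m = u • w) (m : M) :
    m ∈ nilVectors (k := k) M f := by
  obtain ⟨u, rfl⟩ := hgen m
  refine smul_mem_of_ι_smul_mem _ (fun x m hm => ?_) u w hw
  have hx : x ∈ ⨆ a, W a := by rw [hW.iSup_eq_top]; trivial
  induction hx using Submodule.iSup_induction' with
  | zero => rw [map_zero, zero_smul]; exact zero_mem _
  | add x y _ _ hx hy => rw [map_add, add_smul]; exact add_mem hx hy
  | mem a x hx =>
    obtain ⟨n, hn⟩ := hα a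
    exact ι_smul_mem_nilVectors hW hf n a hn x hx m hm

end LocallyNilpotent

/-! ### Weight vectors in `U(L)`-modules and in their truncations. -/

section WeightVectors

theorem mk_eq_zero_of_not_below {k L M : Type*} [Field k] [LieRing L] [LieAlgebra k L]
    [AddCommGroup M] [Module k M] [Module (UniversalEnvelopingAlgebra k L) M] {g : LieSubalgebra k L}
    {H : LieSubalgebra k g} {T : Set (Module.Dual k H)}
    {lam μ : Module.Dual k H}
    (hμ : ¬ Below T μ lam) {m : M} (hm : m ∈ modWtSpace H M μ) :
    (Submodule.Quotient.mk m : Truncation H T lam M) = 0 :=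
  (Submodule.Quotient.mk_eq_zero _).2
    (Submodule.mem_iSup_of_mem μ (Submodule.mem_iSup_of_mem hμ (Submodule.subset_span hm)))

variable {k L : Type*} [Field k] [LieRing L] [LieAlgebra k L] {g : LieSubalgebra k L}
  {H : LieSubalgebra k g} {M : Type*} [AddCommGroup M] [Module k M]
  [Module (UniversalEnvelopingAlgebra k L) M] [IsScalarTower k (UniversalEnvelopingAlgebra k L) M]

local notation "ι" => UniversalEnvelopingAlgebra.ι k

theorem ι_smul_mem_modWtSpace {a μ : Module.Dual k H} {x : L} (hx : x ∈ wtSpace H a) {m : M}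
    (hm : m ∈ modWtSpace H M μ) : ι x • m ∈ modWtSpace H M (a + μ) := by
  intro h
  rw [ι_smul_ι_smul, hm h, hx h, map_smul, smul_assoc, smul_comm (ι x) (μ h) m, LinearMap.add_apply,
    add_smul, add_comm]

theorem IsMonomial.smul_mem_modWtSpace {S : Set (Module.Dual k H)} {μ ν : Module.Dual k H}
    {u : UniversalEnvelopingAlgebra k L} (hu : IsMonomial (wtSpace H) S ν u) {m : M}
    (hm : m ∈ modWtSpace H M μ) : u • m ∈ modWtSpace H M (ν + μ) := by
  induction hu with
  | one => rwa [one_smul, zero_add]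
  | cons _ hx _ ih => rw [mul_smul, add_assoc]; exact ι_smul_mem_modWtSpace hx ih

theorem envMap_zeroAlg_smul_mem_modWtSpace {μ : Module.Dual k H} {m : M}
    (hm : m ∈ modWtSpace H M μ) (z : UniversalEnvelopingAlgebra k (zeroAlg H)) :
    envMap (zeroAlg H) z • m ∈ modWtSpace H M μ := by
  induction z using enveloping_induction with
  | one => rwa [map_one, one_smul]
  | add a b ha hb =>
    intro h
    rw [map_add, add_smul, smul_add, ha h, hb h, smul_add]
  | smul c a ha =>
    intro h
    rw [map_smul, smul_assoc, smul_comm _ c, ha h, smul_comm]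
  | ι_mul x a ha =>
    rw [map_mul, envMap_ι, mul_smul, ← zero_add μ]
    exact ι_smul_mem_modWtSpace x.2 ha

/-- Otherwise `-a` would be a sum over `T`, and adding `a` would give a nonempty vanishing sum. -/
theorem IsTriangularGrading.not_below {T : Set (Module.Dual k H)} {W : Module.Dual k H → Submodule k L}
    (hW : IsTriangularGrading W T) {a : Module.Dual k H} (ha : a ∈ T) (lam : Module.Dual k H) :
    ¬ Below T (a + lam) lam := by
  intro h
  obtain ⟨s, hs, hsum⟩ := AddSubmonoid.exists_multiset_of_mem_closure h
  refine hW.sum_ne_zero (a ::ₘ s) Multiset.cons_ne_zero ?_ ?_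
  · intro b hb
    rcases Multiset.mem_cons.1 hb with rfl | hb
    exacts [ha, hs b hb]
  · rw [Multiset.sum_cons, hsum]
    abel

theorem mk_smul_eq_zero_of_mem_leftSpan {T : Set (Module.Dual k H)} {lam : Module.Dual k H}
    (hW : IsTriangularGrading (wtSpace H : Module.Dual k H → Submodule k L) T) {m : M}
    (hm : m ∈ modWtSpace H M lam) {u : UniversalEnvelopingAlgebra k L}
    (hu : u ∈ leftSpan (wtSpace H) T) :
    (Submodule.Quotient.mk (u • m) : Truncation H T lam M) = 0 := by
  induction hu using Submodule.span_induction with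
  | zero => rw [zero_smul]; rfl
  | add u v _ _ hu hv => rw [add_smul, Submodule.Quotient.mk_add, hu, hv, add_zero]
  | smul v u _ hu => rw [smul_assoc, Submodule.Quotient.mk_smul, hu, smul_zero]
  | mem u hu =>
    obtain ⟨x, hx, rfl⟩ := hu
    refine partSum_induction (wtSpace H)
      (p := fun x => (Submodule.Quotient.mk (ι x • m) : Truncation H T lam M) = 0) hx
      (fun a ha x hx => ?_) ?_ fun x y hx hy => ?_
    · exact mk_eq_zero_of_not_below (hW.not_below ha lam) (ι_smul_mem_modWtSpace hx hm)
    · rw [map_zero, zero_smul]; rfl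
    · rw [map_add, add_smul, Submodule.Quotient.mk_add, hx, hy, add_zero]

theorem isMonomial_ofFn {V : Type*} [AddCommGroup V] {W : V → Submodule k L} {S : Set V} {n : ℕ}
    {β : Fin n → V} {x : Fin n → L} (hβ : ∀ j, β j ∈ S) (hx : ∀ j, x j ∈ W (β j)) :
    IsMonomial W S (∑ j, β j) (List.ofFn fun j => ι (x j)).prod := by
  induction n with
  | zero => simpa using IsMonomial.one
  | succ n ih =>
    rw [Fin.sum_univ_succ, List.ofFn_succ, List.prod_cons]
    exact .cons (hβ 0) (hx 0) (ih (fun j => hβ j.succ) fun j => hx j.succ)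

theorem isMonomial_pow {V : Type*} [AddCommGroup V] {W : V → Submodule k L} {S : Set V}
    {a : V} {x : L} (ha : a ∈ S) (hx : x ∈ W a) (n : ℕ) : IsMonomial W S (n • a) (ι x ^ n) := by
  induction n with
  | zero => rw [zero_smul, pow_zero]; exact .one
  | succ n ih => rw [succ_nsmul', pow_succ']; exact .cons ha hx ih

/-- A nonzero root string in a root graded Lie algebra breaks off. -/
theorem exists_component_eq_bot {V : Type*} [AddCommGroup V] [Module k V] [CharZero k]
    {W : V → Submodule k L} {T R : Set V} (hW : IsTriangularGrading W T) (hR : R.Finite)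
    (hTR : T ⊆ R) (hR' : ∀ a, -a ∈ T → a ∈ R) {α : V} (hα : α ≠ 0) (a : V) :
    ∃ n : ℕ, W (a - n • α) = ⊥ := by
  have hfin : (insert 0 R).Finite := hR.insert 0
  have hinj : Function.Injective fun n : ℕ => a - n • α := by
    intro m n hmn
    have h1 : (m : k) • α = (n : k) • α := by
      rw [Nat.cast_smul_eq_nsmul, Nat.cast_smul_eq_nsmul]
      exact sub_right_injective hmn
    exact_mod_cast smul_left_injective k hα h1
  obtain ⟨n, hn⟩ : ∃ n : ℕ, a - n • α ∉ insert 0 R := by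
    by_contra! h
    exact Set.infinite_range_of_injective hinj (hfin.subset (by rintro _ ⟨n, rfl⟩; exact h n))
  refine ⟨n, hW.eq_bot _ (fun h => hn (Or.inl h)) (fun h => hn (Or.inr (hTR h)))
    fun h => hn (Or.inr (hR' _ h))⟩

end WeightVectors

/-! ### The inclusion of `J^λ` in the annihilator of `w_λ`. -/

section Annihilator

variable {k L : Type*} [Field k] [CharZero k] [LieRing L] [LieAlgebra k L]
  {g : LieSubalgebra k L} [FiniteDimensional k g] [LieAlgebra.IsSemisimple k g]
  {H : LieSubalgebra k g} [H.IsCartanSubalgebra] [LieModule.IsTriangularizable k H g]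
  {b : (LieAlgebra.IsKilling.rootSystem H).Base} {T : Set (Module.Dual k H)}

local notation "ι" => UniversalEnvelopingAlgebra.ι k

theorem simpleRoot_simpleCoroot (i : b.support) : simpleRoot b i (simpleCoroot b i) = 2 :=
  (LieAlgebra.IsKilling.rootSystem H).root_coroot_two i

theorem simpleRoot_ne_zero (i : b.support) : simpleRoot b i ≠ 0 := by
  intro h
  have := simpleRoot_simpleCoroot i
  rw [h, LinearMap.zero_apply] at this
  exact two_ne_zero this.symm

theorem simpleRoot_mem (hTb : T ∩ delta H = deltaPos b) (i : b.support) : simpleRoot b i ∈ T := by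
  have : simpleRoot b i ∈ deltaPos b := ⟨⟨_, rfl⟩, AddSubmonoid.subset_closure ⟨i, rfl⟩⟩
  rw [← hTb] at this
  exact this.1

variable {e f : b.support → g} {lam : Module.Dual k H} {l : b.support → ℕ}
  {M : Type*} [AddCommGroup M] [Module k M] [Module (UniversalEnvelopingAlgebra k L) M]
  [IsScalarTower k (UniversalEnvelopingAlgebra k L) M]

/-- In the truncation, the vectors of weight `λ` are annihilated by `y_1 ⋯ y_n` for
`y_j ∈ L_{-α_i}` and `n = λ(h_i) + 1`, as `s_i(λ - n α_i) = λ + α_i` is not a weight. -/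
theorem mk_monomial_smul_eq_zero
    (hW : IsTriangularGrading (wtSpace H : Module.Dual k H → Submodule k L) T)
    (hTb : T ∩ delta H = deltaPos b) (hef : IsChevalley b e f) (i : b.support)
    (hlam : lam (simpleCoroot b i) = (l i : k))
    (hnil : ∀ m : Truncation H T lam M, m ∈ nilVectors (k := k) _ (f i : L))
    {S : Set (Module.Dual k H)} {y : UniversalEnvelopingAlgebra k L}
    (hy : IsMonomial (wtSpace H) S ((l i + 1) • -simpleRoot b i) y) {m : M}
    (hm : m ∈ modWtSpace H M lam) :
    (Submodule.Quotient.mk (y • m) : Truncation H T lam M) = 0 := by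
  set α := simpleRoot b i with hα
  have hz := hy.smul_mem_modWtSpace hm
  obtain ⟨a, ha⟩ := mem_nilVectors.1 (hnil (Submodule.Quotient.mk (y • m)))
  have h2 : α (simpleCoroot b i) = 2 := simpleRoot_simpleCoroot i
  have hhe : ⁅((simpleCoroot b i : g) : L), (e i : L)⁆ = (2 : k) • (e i : L) := by
    rw [← h2]; exact hef.e_mem i _
  have hhf : ⁅((simpleCoroot b i : g) : L), (f i : L)⁆ = -((2 : k) • (f i : L)) := by
    rw [← h2, ← neg_smul]; exact hef.f_mem i _
  have hef' : ⁅(e i : L), (f i : L)⁆ = ((simpleCoroot b i : g) : L) := by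
    rw [← hef.lie_e_f i]; rfl
  -- The triple is used upside down, as `(f_i, -h_i, e_i)`. For `-h_i` the vector `y m` has weight
  -- `-(ℓ_i - 2 (ℓ_i + 1)) = ℓ_i + 2`, and `e_i ^ (ℓ_i + 2)` moves it to the weight `λ + α_i`.
  refine eq_zero_of_pow_f_eq_zero (k := k) (e := actEnd k _ (f i : L)) (f := actEnd k _ (e i : L))
    (h := actEnd k _ (-((simpleCoroot b i : g) : L))) ?_ ?_ ?_ a (l i + 2) _ ?_ ?_ ?_
  · intro m
    simp only [actEnd_apply]
    rw [ι_smul_ι_smul, ← lie_skew, hef']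
  · intro m
    simp only [actEnd_apply]
    rw [ι_smul_ι_smul, neg_lie, hhe, map_neg ι ((2 : k) • (e i : L)), map_smul, neg_smul,
      smul_assoc, sub_eq_add_neg]
  · intro m
    simp only [actEnd_apply]
    rw [ι_smul_ι_smul, neg_lie, hhf, neg_neg, map_smul, smul_assoc]
  · rw [actEnd_apply, ← Submodule.Quotient.mk_smul, map_neg, neg_smul, hz (simpleCoroot b i),
      ← neg_smul]
    have hc : -((((l i + 1) • -α + lam : Module.Dual k H)) (simpleCoroot b i))
        = ((l i + 2 : ℕ) : k) := by
      rw [LinearMap.add_apply, LinearMap.smul_apply, LinearMap.neg_apply, h2, hlam, nsmul_eq_mul]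
      push_cast
      ring
    rw [hc]
    rfl
  · rw [actEnd_pow_apply]; exact ha
  · rw [actEnd_pow_apply, ← Submodule.Quotient.mk_smul]
    have hw := (isMonomial_pow (W := wtSpace H) (S := Set.univ) (Set.mem_univ α) (hef.e_mem i)
      (l i + 2)).smul_mem_modWtSpace hz
    refine mk_eq_zero_of_not_below ?_ hw
    have e1 : (l i + 2) • α + ((l i + 1) • -α + lam) = α + lam := by
      rw [← add_assoc, smul_neg, succ_nsmul α (l i + 1)]
      abel
    rw [e1]
    exact hW.not_below (simpleRoot_mem hTb i) lam

/-- If a `U(L)`-module is generated by a vector `p` of weight `λ` with `f_i ^ (ℓ_i + 1) p = 0`,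
then `J^λ` annihilates the image of `p` in its truncation. -/
theorem envMap_smul_mk_eq_zero_of_mem_seligmanIdeal
    (hW : IsTriangularGrading (wtSpace H : Module.Dual k H → Submodule k L) T)
    (hbot : ∀ i a, ∃ n : ℕ, (wtSpace H (a - n • simpleRoot b i) : Submodule k L) = ⊥)
    (hTb : T ∩ delta H = deltaPos b) (hef : IsChevalley b e f)
    (hlam : ∀ i, lam (simpleCoroot b i) = (l i : k)) {p : M} (hp : p ∈ modWtSpace H M lam)
    (hgen : ∀ m : M, ∃ u : UniversalEnvelopingAlgebra k L, m = u • p)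
    (hfp : ∀ i, ι (f i : L) ^ (l i + 1) • p = 0)
    {z : UniversalEnvelopingAlgebra k (zeroAlg H)} (hz : z ∈ seligmanIdeal b T l) :
    envMap (zeroAlg H) z • (Submodule.Quotient.mk p : Truncation H T lam M) = 0 := by
  have hnil : ∀ i, ∀ m : Truncation H T lam M, m ∈ nilVectors (k := k) _ (f i : L) := by
    intro i
    refine nilVectors_eq_top hW (α := simpleRoot b i) (hef.f_mem i) (hbot i)
      (w := Submodule.Quotient.mk p) (mem_nilVectors.2 ⟨l i + 1, ?_⟩) fun m => ?_
    · rw [← Submodule.Quotient.mk_smul, hfp i]; rfl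
    · obtain ⟨m, rfl⟩ := Submodule.Quotient.mk_surjective _ m
      obtain ⟨u, rfl⟩ := hgen m
      exact ⟨u, rfl⟩
  -- Quantifying over the right factor `u` makes this a two-sided ideal inside the annihilator, so
  -- only generators of `J^λ` need checking, on all `u • p`.
  let I : TwoSidedIdeal (UniversalEnvelopingAlgebra k (zeroAlg H)) :=
    TwoSidedIdeal.mk' {z | ∀ u, envMap (zeroAlg H) (z * u) •
        (Submodule.Quotient.mk p : Truncation H T lam M) = 0}
      (fun u => by rw [zero_mul, map_zero, zero_smul])
      (fun {x y} hx hy u => by rw [add_mul, map_add, add_smul, hx u, hy u, add_zero])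
      (fun {x} hx u => by rw [neg_mul, map_neg, neg_smul, hx u, neg_zero])
      (fun {x y} hy u => by rw [mul_assoc, map_mul, mul_smul, hy u, smul_zero])
      (fun {x y} hx u => by rw [mul_assoc]; exact hx _)
  have hzI : z ∈ I := by
    refine TwoSidedIdeal.mem_span_iff.1 (TwoSidedIdeal.mem_asIdeal.1 hz) I ?_
    intro q hq
    obtain ⟨i, hq⟩ := Set.mem_iUnion.1 hq
    refine (TwoSidedIdeal.mem_mk' _ _ _ _ _ _ _).2 fun u => ?_
    have hm := envMap_zeroAlg_smul_mem_modWtSpace hp u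
    rw [map_mul, mul_smul, ← Submodule.Quotient.mk_smul, ← Submodule.Quotient.mk_smul]
    generalize envMap (zeroAlg H) u • p = m at hm
    rcases hq with ⟨n, β, x, y, -, -, hy, -, hK⟩ | rfl
    -- `x y - π₀(x y)` lies in `U(L) L₊`, so both act alike on a vector of weight `λ`.
    · have h1 := mk_smul_eq_zero_of_mem_leftSpan hW hm hK.2.1
      rw [sub_smul, Submodule.Quotient.mk_sub, sub_eq_zero] at h1
      rw [← h1, mul_smul, Submodule.Quotient.mk_smul]
      have h2 := isMonomial_ofFn (S := Set.univ) (fun _ => Set.mem_univ _) hy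
      rw [Finset.sum_const, Finset.card_univ, Fintype.card_fin] at h2
      rw [mk_monomial_smul_eq_zero hW hTb hef i (hlam i) (hnil i) h2 hm, smul_zero]
    · have h1 := hm (simpleCoroot b i)
      rw [map_sub, envMap_ι, AlgHom.commutes, sub_smul, algebraMap_smul]
      change (Submodule.Quotient.mk (ι ((simpleCoroot b i : g) : L) • m - (l i : k) • m) :
        Truncation H T lam M) = 0
      rw [h1, hlam, sub_self]
      rfl
  have := (TwoSidedIdeal.mem_mk' _ _ _ _ _ _ _).1 hzI 1
  rwa [mul_one] at this

end Annihilator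

/-! ### Monomials as indexed products, and the centralizer of the Cartan subalgebra. -/

section Monomials

variable {k L : Type*} [Field k] [LieRing L] [LieAlgebra k L]

local notation "ι" => UniversalEnvelopingAlgebra.ι k

theorem IsMonomial.exists_ofFn {V : Type*} [AddCommGroup V] {W : V → Submodule k L} {S : Set V}
    {ν : V} {u : UniversalEnvelopingAlgebra k L} (hu : IsMonomial W S ν u) :
    ∃ (n : ℕ) (β : Fin n → V) (x : Fin n → L), (∀ j, β j ∈ S) ∧ (∀ j, x j ∈ W (β j)) ∧
      ∑ j, β j = ν ∧ u = (List.ofFn fun j => ι (x j)).prod := by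
  induction hu with
  | one => exact ⟨0, Fin.elim0, Fin.elim0, fun j => j.elim0, fun j => j.elim0, by simp, by simp⟩
  | @cons a ν t u ha ht _ ih =>
    obtain ⟨n, β, x, hβ, hx, hsum, rfl⟩ := ih
    refine ⟨n + 1, Fin.cons a β, Fin.cons t x, ?_, ?_, ?_, ?_⟩
    · exact Fin.cases ha hβ
    · exact Fin.cases ht hx
    · rw [Fin.sum_univ_succ, Fin.cons_zero]
      simp only [Fin.cons_succ, hsum]
    · rw [List.ofFn_succ, List.prod_cons, Fin.cons_zero]
      simp only [Fin.cons_succ]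

variable {g : LieSubalgebra k L} {H : LieSubalgebra k g}

theorem IsMonomial.ι_cartan_mul {S : Set (Module.Dual k H)} {ν : Module.Dual k H}
    {u : UniversalEnvelopingAlgebra k L} (hu : IsMonomial (wtSpace H) S ν u) (h : H) :
    ι ((h : g) : L) * u = u * ι ((h : g) : L) + ν h • u := by
  induction hu with
  | one => rw [mul_one, one_mul, LinearMap.zero_apply, zero_smul, add_zero]
  | cons _ hx _ ih =>
    rw [← mul_assoc, ι_mul_ι, add_mul, mul_assoc, ih, hx h, map_smul, mul_add, mul_smul_comm,
      smul_mul_assoc, LinearMap.add_apply, add_smul, mul_assoc, add_assoc, add_comm (_ • _)]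

theorem IsMonomial.mem_envZero {S : Set (Module.Dual k H)} {u : UniversalEnvelopingAlgebra k L}
    (hu : IsMonomial (wtSpace H) S 0 u) : u ∈ envZero H := by
  intro h
  rw [hu.ι_cartan_mul h, LinearMap.zero_apply, zero_smul, add_zero, sub_self]

theorem zeroAlg_toSubmodule :
    (zeroAlg H : LieSubalgebra k L).toSubmodule = wtSpace H 0 := rfl

theorem envMap_mem_envZero (z : UniversalEnvelopingAlgebra k (zeroAlg H)) :
    envMap (zeroAlg H) z ∈ (envZero H : Submodule k (UniversalEnvelopingAlgebra k L)) := by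
  induction z using enveloping_induction with
  | one => intro h; rw [map_one, mul_one, one_mul, sub_self]
  | add a b ha hb => rw [map_add]; exact add_mem ha hb
  | smul c a ha => rw [map_smul]; exact Submodule.smul_mem _ c ha
  | ι_mul x a ha =>
    intro h
    have hx : ⁅((h : g) : L), (x : L)⁆ = 0 := by
      have := x.2 h
      rwa [LinearMap.zero_apply, zero_smul] at this
    rw [map_mul, envMap_ι, ← mul_assoc, ι_mul_ι, hx, map_zero, add_zero, mul_assoc, mul_assoc,
      ← mul_sub, ha h, mul_zero]

end Monomials

/-! ### The left ideal `I` of `U(L)`: its projection to `U(L₀)` and the weights of `U(L) / I`. -/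

section WeylIdeal

variable {k L : Type*} [Field k] [CharZero k] [LieRing L] [LieAlgebra k L]
  {g : LieSubalgebra k L} [FiniteDimensional k g] [LieAlgebra.IsSemisimple k g]
  {H : LieSubalgebra k g} [H.IsCartanSubalgebra] [LieModule.IsTriangularizable k H g]

local notation "ι" => UniversalEnvelopingAlgebra.ι k

/-- The left ideal of `U(L)` generated by `L₊`, the elements `h - λ(h)` and the elements
`f_i ^ (ℓ_i + 1)`. -/
noncomputable def weylIdeal (b : (LieAlgebra.IsKilling.rootSystem H).Base)
    (T : Set (Module.Dual k H)) (f : b.support → g) (lam : Module.Dual k H) (l : b.support → ℕ) :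
    Ideal (UniversalEnvelopingAlgebra k L) :=
  Ideal.span (ι '' (partSum (wtSpace H) T : Set L) ∪
    {z | ∃ h : H, z = ι ((h : g) : L) - algebraMap k _ (lam h)} ∪
    {z | ∃ i, z = ι (f i : L) ^ (l i + 1)})

variable {b : (LieAlgebra.IsKilling.rootSystem H).Base} {T : Set (Module.Dual k H)}
  {e f : b.support → g} {lam : Module.Dual k H} {l : b.support → ℕ}

/-- The elements of the Cartan subalgebra as elements of `L₀`. -/
def cartanZero (H : LieSubalgebra k g) [H.IsCartanSubalgebra] :
    H →ₗ[k] (zeroAlg H : LieSubalgebra k L) where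
  toFun h := ⟨((h : g) : L), fun h' => by
    rw [lie_cartan_eq_zero, LinearMap.zero_apply, zero_smul]⟩
  map_add' _ _ := rfl
  map_smul' _ _ := rfl

theorem span_simpleCoroot (b : (LieAlgebra.IsKilling.rootSystem H).Base) :
    Submodule.span k (Set.range (simpleCoroot b)) = ⊤ := by
  have h1 := b.span_coroot_support
  have h2 : (LieAlgebra.IsKilling.rootSystem H).coroot '' b.support
      = Set.range (simpleCoroot b) := by
    rw [Set.image_eq_range]; rfl
  rw [← h2, h1]
  exact RootPairing.IsRootSystem.span_coroot_eq_top

/-- The generators of `J^λ` cover only the `h_i`, but the simple coroots span `𝔥` and the condition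
is linear in `h`. -/
theorem cartanZero_sub_mem_seligmanIdeal (hlam : ∀ i, lam (simpleCoroot b i) = (l i : k)) (h : H) :
    UniversalEnvelopingAlgebra.ι k (cartanZero (L := L) H h) - algebraMap k _ (lam h)
      ∈ seligmanIdeal b T l := by
  have hh : h ∈ Submodule.span k (Set.range (simpleCoroot b)) := by
    rw [span_simpleCoroot]; trivial
  induction hh using Submodule.span_induction with
  | mem h hh =>
    obtain ⟨i, rfl⟩ := hh
    rw [hlam]
    exact TwoSidedIdeal.mem_asIdeal.2
      (TwoSidedIdeal.subset_span (Set.mem_iUnion.2 ⟨i, Or.inr rfl⟩))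
  | zero => rw [map_zero, map_zero, map_zero, map_zero, sub_zero]; exact Ideal.zero_mem _
  | add x y _ _ hx hy =>
    rw [map_add, map_add, map_add, map_add, add_sub_add_comm]
    exact Ideal.add_mem _ hx hy
  | smul c x _ hx =>
    rw [map_smul, map_smul, map_smul, Algebra.algebraMap_eq_smul_one, smul_assoc, ← smul_sub,
      ← Algebra.algebraMap_eq_smul_one,
      ← algebraMap_smul (UniversalEnvelopingAlgebra k (zeroAlg H)) c]
    exact Submodule.smul_mem _ _ hx

/-- The Harish-Chandra projection maps the defining left ideal of the global Weyl module to
`J^λ`. -/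
theorem hcProj_mem_seligmanIdeal
    (hW : IsTriangularGrading (wtSpace H : Module.Dual k H → Submodule k L) T)
    (hef : IsChevalley b e f) (hlam : ∀ i, lam (simpleCoroot b i) = (l i : k))
    {u : UniversalEnvelopingAlgebra k L} (hu : u ∈ weylIdeal b T f lam l) :
    hW.hcProj (L₀ := zeroAlg H) zeroAlg_toSubmodule u ∈ seligmanIdeal b T l := by
  refine hW.hcProj_mem_of_mem_span zeroAlg_toSubmodule (fun q hq ν x hx => ?_) hu
  rcases hq with (⟨y, hy, rfl⟩ | ⟨h, rfl⟩) | ⟨i, rfl⟩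
  · rw [hW.hcProj_of_mem_leftSpan zeroAlg_toSubmodule (mul_ι_mem_leftSpan x hy)]
    exact Ideal.zero_mem _
  · rcases hx.eq_one_or_mem_leftSpan with ⟨rfl, -⟩ | hx'
    · have h1 : (1 : UniversalEnvelopingAlgebra k L) * (ι ((h : g) : L) - algebraMap k _ (lam h))
          = envMap (zeroAlg H) (UniversalEnvelopingAlgebra.ι k (cartanZero (L := L) H h)
            - algebraMap k _ (lam h)) := by
        rw [map_sub, envMap_ι, AlgHom.commutes, one_mul]; rfl
      rw [h1, hW.hcProj_envMap]
      exact cartanZero_sub_mem_seligmanIdeal hlam h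
    -- `x h = h x - ν(h) x`, so multiplying on the right by `h - λ(h)` keeps `x` inside `U(L) L₊`.
    · have h1 : x * (ι ((h : g) : L) - algebraMap k _ (lam h)) ∈ leftSpan (wtSpace H) T := by
        rw [mul_sub, ← Algebra.commutes (lam h) x, eq_sub_of_add_eq (hx.ι_cartan_mul h).symm,
          ← smul_eq_mul (ι ((h : g) : L)), ← smul_eq_mul (algebraMap k _ (lam h)),
          ← algebraMap_smul (UniversalEnvelopingAlgebra k L) (ν h)]
        exact sub_mem (sub_mem (Submodule.smul_mem _ _ hx') (Submodule.smul_mem _ _ hx'))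
          (Submodule.smul_mem _ _ hx')
      rw [hW.hcProj_of_mem_leftSpan zeroAlg_toSubmodule h1]
      exact Ideal.zero_mem _
  · have hm : IsMonomial (wtSpace H) Set.univ (ν + (l i + 1) • -simpleRoot b i)
        (x * ι (f i : L) ^ (l i + 1)) :=
      (hx.mono (Set.subset_univ T)).mul (isMonomial_pow (Set.mem_univ _) (hef.f_mem i) _)
    have ht := hW.mem_triangularSpan (L₀ := zeroAlg H) zeroAlg_toSubmodule hm
    -- In degree zero the projection of `x f_i ^ (ℓ_i + 1)` is a generator of `J^λ`, with all `y_j =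
    -- f_i`. In any other degree it vanishes.
    by_cases hν : ν = (l i + 1) • simpleRoot b i
    · rw [hν, smul_neg, add_neg_cancel] at hm ht
      refine TwoSidedIdeal.mem_asIdeal.2
        (TwoSidedIdeal.subset_span (Set.mem_iUnion.2 ⟨i, Or.inl ?_⟩))
      obtain ⟨n, β, y, hβ, hy, hsum, rfl⟩ := hx.exists_ofFn
      refine ⟨n, β, y, fun _ => (f i : L), hβ, hy, fun _ => hef.f_mem i, hsum.trans hν, ?_⟩
      rw [List.ofFn_const, List.prod_replicate]
      exact ⟨hm.mem_envZero, hW.sub_envMap_hcProj_mem zeroAlg_toSubmodule ht,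
        sub_mem hm.mem_envZero (envMap_mem_envZero _)⟩
    · rw [hW.hcProj_eq_zero_of_ne_zero zeroAlg_toSubmodule ?_ ht]
      · exact Ideal.zero_mem _
      · rw [smul_neg, ← sub_eq_add_neg]
        exact sub_ne_zero_of_ne hν

/-- All weights `μ` of `U(L) / I` satisfy `μ ⪯ λ`, where `I` is the defining left ideal of the
global Weyl module. -/
theorem eq_zero_of_mem_modWtSpace_of_not_below
    (hW : IsTriangularGrading (wtSpace H : Module.Dual k H → Submodule k L) T)
    {μ : Module.Dual k H} (hμ : ¬ Below T μ lam)
    {m : UniversalEnvelopingAlgebra k L ⧸ weylIdeal b T f lam l}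
    (hm : m ∈ modWtSpace H (UniversalEnvelopingAlgebra k L ⧸ weylIdeal b T f lam l) μ) : m = 0 := by
  have hgen : (Submodule.Quotient.mk 1 : UniversalEnvelopingAlgebra k L ⧸ weylIdeal b T f lam l) ∈
      modWtSpace H (UniversalEnvelopingAlgebra k L ⧸ weylIdeal b T f lam l) lam := by
    intro h
    rw [← Submodule.Quotient.mk_smul, ← Submodule.Quotient.mk_smul, smul_eq_mul, mul_one,
      ← Algebra.algebraMap_eq_smul_one]
    exact (Submodule.Quotient.eq _).2 (Ideal.subset_span (Or.inl (Or.inr ⟨h, rfl⟩)))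
  refine eq_zero_of_weight_notMem
    (fun h : H => actEnd k (UniversalEnvelopingAlgebra k L ⧸ weylIdeal b T f lam l)
      ((h : g) : L)) ?_ (Λ := {χ | ∃ ν, Below T ν lam ∧ χ = ν}) (m := m) (χ := μ) ?_ ?_ hm
  · intro h h'
    refine LinearMap.ext fun v => ?_
    change ι ((h : g) : L) • ι ((h' : g) : L) • v = ι ((h' : g) : L) • ι ((h : g) : L) • v
    rw [ι_smul_ι_smul, lie_cartan_eq_zero, map_zero, zero_smul, add_zero]
  · obtain ⟨u, rfl⟩ := Submodule.Quotient.mk_surjective _ m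
    clear hm
    induction u using hW.triangular_induction (L₀ := zeroAlg H) zeroAlg_toSubmodule with
    | zero => exact zero_mem _
    | add u v hu hv => exact add_mem hu hv
    | smul c u hu => exact Submodule.smul_mem _ c hu
    | mem ν₁ ν₂ y z x hy hx =>
      -- Modulo `I` a nonempty positive part disappears. The remaining vectors `y z 1` have weight
      -- `ν₁ + λ` with `-ν₁ ∈ ℕ[Θ₊]`, so `U(L) / I` is spanned by weight vectors of weights below
      -- `λ`.
      rcases hx.eq_one_or_mem_leftSpan with ⟨rfl, -⟩ | hx'
      · have h1 := hy.smul_mem_modWtSpace (envMap_zeroAlg_smul_mem_modWtSpace hgen z)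
        refine Submodule.subset_span ⟨_, ⟨ν₁ + lam, ?_, rfl⟩, ?_⟩
        · obtain ⟨s, hs, hsum, -⟩ := hy.exists_multiset
          have h2 : lam - (ν₁ + lam) = (s.map fun a => -a).sum := by
            rw [Multiset.sum_map_neg, Multiset.map_id', hsum]
            abel
          unfold Below
          rw [h2]
          refine AddSubmonoid.multiset_sum_mem _ _ fun a ha => ?_
          obtain ⟨c, hc, rfl⟩ := Multiset.mem_map.1 ha
          exact AddSubmonoid.subset_closure (hs c hc)
        · rw [← Submodule.Quotient.mk_smul, ← Submodule.Quotient.mk_smul, smul_eq_mul,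
            smul_eq_mul] at h1
          exact h1
      · have h1 : leftSpan (wtSpace H) T ≤ weylIdeal b T f lam l :=
          Submodule.span_mono fun _ h => Or.inl (Or.inl h)
        have h2 : (Submodule.Quotient.mk (y * (envMap (zeroAlg H) z * x)) :
            UniversalEnvelopingAlgebra k L ⧸ weylIdeal b T f lam l) = 0 :=
          (Submodule.Quotient.mk_eq_zero _).2 (h1
            (Submodule.smul_mem _ y (Submodule.smul_mem _ (envMap (zeroAlg H) z) hx')))
        rw [h2]
        exact zero_mem _
  · rintro ⟨ν, hν, h⟩
    exact hμ (by rwa [DFunLike.coe_injective h])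

/-- Generators go to generators, as `Δ₊ ⊆ Θ₊`. This makes the map `V(λ) → U(L) / I` well defined. -/
theorem envMap_mem_weylIdeal (hTb : T ∩ delta H = deltaPos b) {a : UniversalEnvelopingAlgebra k g}
    (ha : a ∈ simpleIdeal b f lam l) : envMap g a ∈ weylIdeal b T f lam l := by
  induction ha using Submodule.span_induction with
  | zero => rw [map_zero]; exact Ideal.zero_mem _
  | add x y _ _ hx hy => rw [map_add]; exact Ideal.add_mem _ hx hy
  | smul c x _ hx => rw [smul_eq_mul, map_mul]; exact Ideal.mul_mem_left _ _ hx
  | mem x hx =>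
    refine Ideal.subset_span ?_
    rcases hx with (⟨c, hc, x, hx, rfl⟩ | ⟨h, rfl⟩) | ⟨i, rfl⟩
    · rw [envMap_ι]
      rw [← hTb] at hc
      exact Or.inl (Or.inl ⟨_, le_partSum _ hc.1 hx, rfl⟩)
    · rw [map_sub, envMap_ι, AlgHom.commutes]
      exact Or.inl (Or.inr ⟨h, rfl⟩)
    · rw [map_pow, envMap_ι]
      exact Or.inr ⟨i, rfl⟩

end WeylIdeal

/-! ### The map from the global Weyl module to `U(L) / I`, and the equality of the two ideals. -/

section GlobalWeyl

variable {k L : Type*} [Field k] [CharZero k] [LieRing L] [LieAlgebra k L]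
  {g : LieSubalgebra k L} [FiniteDimensional k g] [LieAlgebra.IsSemisimple k g]
  {H : LieSubalgebra k g} [H.IsCartanSubalgebra] [LieModule.IsTriangularizable k H g]
  {b : (LieAlgebra.IsKilling.rootSystem H).Base} {T : Set (Module.Dual k H)}
  {f : b.support → g} {lam : Module.Dual k H} {l : b.support → ℕ}

local notation "ι" => UniversalEnvelopingAlgebra.ι k

/-- The generator `1 ⊗ v_λ` of the induced module. -/
noncomputable def inducedGen (b : (LieAlgebra.IsKilling.rootSystem H).Base) (f : b.support → g)
    (lam : Module.Dual k H) (l : b.support → ℕ) : Induced g (SimpleModule b f lam l) :=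
  Submodule.Quotient.mk ((1 : UniversalEnvelopingAlgebra k L) ⊗ₜ[k]
    (Submodule.Quotient.mk 1 : SimpleModule b f lam l))

theorem mk_tmul_mk (u : UniversalEnvelopingAlgebra k L) (a : UniversalEnvelopingAlgebra k g) :
    (Submodule.Quotient.mk (u ⊗ₜ[k] (Submodule.Quotient.mk a : SimpleModule b f lam l)) :
      Induced g (SimpleModule b f lam l)) = (u * envMap g a) • inducedGen b f lam l := by
  have h1 : (Submodule.Quotient.mk a : SimpleModule b f lam l)
      = a • (Submodule.Quotient.mk 1 : SimpleModule b f lam l) := by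
    rw [← Submodule.Quotient.mk_smul, smul_eq_mul, mul_one]
  rw [inducedGen, ← Submodule.Quotient.mk_smul, TensorProduct.smul_tmul', smul_eq_mul, mul_one, h1]
  exact ((Submodule.Quotient.eq (balancedRelations g _)).2
    (Submodule.subset_span ⟨u, a, _, rfl⟩)).symm

theorem envMap_smul_inducedGen (a : UniversalEnvelopingAlgebra k g) :
    envMap g a • inducedGen b f lam l = (Submodule.Quotient.mk ((1 : UniversalEnvelopingAlgebra k L)
      ⊗ₜ[k] (Submodule.Quotient.mk a : SimpleModule b f lam l)) :
        Induced g (SimpleModule b f lam l)) := by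
  rw [mk_tmul_mk, one_mul]

theorem envMap_smul_inducedGen_eq_zero {a : UniversalEnvelopingAlgebra k g}
    (ha : a ∈ simpleIdeal b f lam l) :
    envMap g a • (inducedGen b f lam l : Induced g (SimpleModule b f lam l)) = 0 := by
  rw [envMap_smul_inducedGen, (Submodule.Quotient.mk_eq_zero _).2 ha, TensorProduct.tmul_zero]
  rfl

theorem exists_smul_inducedGen (m : Induced g (SimpleModule b f lam l)) :
    ∃ u : UniversalEnvelopingAlgebra k L, m = u • inducedGen b f lam l := by
  obtain ⟨m, rfl⟩ := Submodule.Quotient.mk_surjective _ m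
  induction m using TensorProduct.induction_on with
  | zero => exact ⟨0, by rw [zero_smul]; rfl⟩
  | add x y hx hy =>
    obtain ⟨u, hu⟩ := hx
    obtain ⟨v, hv⟩ := hy
    exact ⟨u + v, by rw [add_smul, ← hu, ← hv]; rfl⟩
  | tmul u v =>
    obtain ⟨a, rfl⟩ := Submodule.Quotient.mk_surjective _ v
    exact ⟨_, mk_tmul_mk u a⟩

theorem inducedGen_mem_modWtSpace :
    inducedGen b f lam l ∈ modWtSpace H (Induced g (SimpleModule b f lam l)) lam := by
  intro h
  have h1 := envMap_smul_inducedGen_eq_zero (b := b) (f := f) (lam := lam) (l := l)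
    (a := UniversalEnvelopingAlgebra.ι k (h : g) - algebraMap k _ (lam h))
    (Ideal.subset_span (Or.inl (Or.inr ⟨h, rfl⟩)))
  rwa [map_sub, envMap_ι, AlgHom.commutes, sub_smul, algebraMap_smul, sub_eq_zero] at h1

theorem pow_smul_inducedGen (i : b.support) :
    ι (f i : L) ^ (l i + 1) •
      (inducedGen b f lam l : Induced g (SimpleModule b f lam l)) = 0 := by
  rw [← envMap_ι, ← map_pow]
  exact envMap_smul_inducedGen_eq_zero (Ideal.subset_span (Or.inr ⟨i, rfl⟩))

/-- The homomorphism `V(λ) → U(L) / I` that maps `v_λ` to the class of `1`. -/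
noncomputable def simpleToQuotient (hTb : T ∩ delta H = deltaPos b) :
    SimpleModule b f lam l →ₗ[k] UniversalEnvelopingAlgebra k L ⧸ weylIdeal b T f lam l :=
  ((simpleIdeal b f lam l).restrictScalars k).liftQ
      (((weylIdeal b T f lam l).mkQ.restrictScalars k) ∘ₗ (envMap g).toLinearMap)
      (fun _ ha => (Submodule.Quotient.mk_eq_zero _).2 (envMap_mem_weylIdeal hTb ha)) ∘ₗ
    (Submodule.Quotient.restrictScalarsEquiv k (simpleIdeal b f lam l)).symm.toLinearMap

theorem simpleToQuotient_mk (hTb : T ∩ delta H = deltaPos b) (a : UniversalEnvelopingAlgebra k g) :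
    simpleToQuotient (lam := lam) (l := l) (f := f) hTb (Submodule.Quotient.mk a)
      = Submodule.Quotient.mk (envMap g a) := rfl

/-- The homomorphism `P(V(λ)) → U(L) / I` that maps `1 ⊗ v_λ` to the class of `1`. -/
noncomputable def inducedToQuotient (hTb : T ∩ delta H = deltaPos b) :
    Induced g (SimpleModule b f lam l) →ₗ[UniversalEnvelopingAlgebra k L]
      UniversalEnvelopingAlgebra k L ⧸ weylIdeal b T f lam l :=
  (balancedRelations g (SimpleModule b f lam l)).liftQ
    (TensorProduct.AlgebraTensorModule.lift
      { toFun := fun u => Algebra.lsmul k k _ u ∘ₗ simpleToQuotient hTb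
        map_add' := fun u v => by rw [map_add, LinearMap.add_comp]
        map_smul' := fun u v => by rw [smul_eq_mul, map_mul]; rfl })
    (Submodule.span_le.2 (by
      rintro _ ⟨u, a, v, rfl⟩
      obtain ⟨c, rfl⟩ := Submodule.Quotient.mk_surjective _ v
      refine LinearMap.mem_ker.2 ?_
      rw [map_sub, TensorProduct.AlgebraTensorModule.lift_apply,
        TensorProduct.AlgebraTensorModule.lift_apply, TensorProduct.lift.tmul,
        TensorProduct.lift.tmul]
      change (u * envMap g a) • simpleToQuotient hTb (Submodule.Quotient.mk c)
        - u • simpleToQuotient hTb (Submodule.Quotient.mk (a * c)) = 0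
      rw [simpleToQuotient_mk, simpleToQuotient_mk, map_mul, mul_smul, sub_eq_zero]
      rfl))

theorem inducedToQuotient_gen (hTb : T ∩ delta H = deltaPos b) :
    inducedToQuotient (T := T) hTb (inducedGen b f lam l) = Submodule.Quotient.mk 1 := by
  change (1 : UniversalEnvelopingAlgebra k L) • simpleToQuotient hTb (Submodule.Quotient.mk 1) = _
  rw [simpleToQuotient_mk, map_one, one_smul]

/-- The homomorphism `W(λ) → U(L) / I` that maps `w_λ` to the class of `1`. -/
noncomputable def weylToQuotient
    (hW : IsTriangularGrading (wtSpace H : Module.Dual k H → Submodule k L) T)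
    (hTb : T ∩ delta H = deltaPos b) :
    Weyl b T f lam l →ₗ[UniversalEnvelopingAlgebra k L]
      UniversalEnvelopingAlgebra k L ⧸ weylIdeal b T f lam l :=
  (truncSubmodule H T lam (Induced g (SimpleModule b f lam l))).liftQ (inducedToQuotient hTb)
    -- A `U(L)`-linear map preserves weights, and `U(L) / I` has no nonzero vector of weight `μ ⋠
    -- λ`.
    (iSup₂_le fun _ hμ => Submodule.span_le.2 fun m hm =>
      LinearMap.mem_ker.2 (eq_zero_of_mem_modWtSpace_of_not_below hW hμ fun h => by
        rw [← map_smul, hm h, LinearMap.map_smul_of_tower]))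

/-- `z w_λ = 0` is mapped to the vanishing of the class of `z` in `U(L) / I`. Only this direction of
`W(λ) ≅ U(L) / I` is needed. -/
theorem envMap_mem_weylIdeal_of_mem_weylAnn
    (hW : IsTriangularGrading (wtSpace H : Module.Dual k H → Submodule k L) T)
    (hTb : T ∩ delta H = deltaPos b) {z : UniversalEnvelopingAlgebra k (zeroAlg H)}
    (hz : z ∈ weylAnn b T f lam l) : envMap (zeroAlg H) z ∈ weylIdeal b T f lam l := by
  have h1 : envMap (zeroAlg H) z • weylGen b T f lam l = 0 := hz
  have h2 := congrArg (weylToQuotient hW hTb) h1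
  have h3 : weylToQuotient hW hTb (weylGen b T f lam l) = Submodule.Quotient.mk 1 :=
    inducedToQuotient_gen hTb
  rw [map_smul, map_zero, h3, ← Submodule.Quotient.mk_smul, smul_eq_mul, mul_one] at h2
  exact (Submodule.Quotient.mk_eq_zero _).1 h2

theorem seligmanIdeal_eq_weylAnn {N X : Type*} [AddCommGroup N] [Module k N] [Finite X]
    {P : RootPairing X k (Module.Dual k H) N} [P.IsCrystallographic] (hL : IsRootGraded H P)
    (hT : IsPositiveSystem (roots P) T) (hTb : T ∩ delta H = deltaPos b) {e : b.support → g}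
    (hef : IsChevalley b e f) (hlam : ∀ i, lam (simpleCoroot b i) = (l i : k)) :
    seligmanIdeal b T l = weylAnn b T f lam l := by
  have hW := hL.isTriangularGrading hT
  refine le_antisymm (fun z hz => ?_) fun z hz => ?_
  · have hbot : ∀ i a, ∃ n : ℕ, (wtSpace H (a - n • simpleRoot b i) : Submodule k L) = ⊥ := by
      intro i a
      refine exists_component_eq_bot hW (R := roots P) (Set.finite_range _) ?_ ?_
        (simpleRoot_ne_zero i) a
      · rw [hT.eq_union]; exact Set.subset_union_left
      · intro c hc
        rw [hT.eq_union]
        exact Or.inr hc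
    exact envMap_smul_mk_eq_zero_of_mem_seligmanIdeal hW hbot hTb hef hlam
      inducedGen_mem_modWtSpace exists_smul_inducedGen pow_smul_inducedGen hz
  · have h1 := hcProj_mem_seligmanIdeal hW hef hlam (envMap_mem_weylIdeal_of_mem_weylAnn hW hTb hz)
    rwa [hW.hcProj_envMap] at h1

end GlobalWeyl

end RootGraded

open RootGraded
theorem theorem4p8 {k L N ι : Type*} [Field k] [CharZero k] [LieRing L] [LieAlgebra k L]
    [AddCommGroup N] [Module k N] [Finite ι]
    (g : LieSubalgebra k L) [FiniteDimensional k g] [LieAlgebra.IsSemisimple k g]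
    (H : LieSubalgebra k g) [H.IsCartanSubalgebra] [LieModule.IsTriangularizable k H g]
    (P : RootPairing ι k (Module.Dual k H) N) [P.IsRootSystem] [P.IsCrystallographic]
    (hL : IsRootGraded H P)
    (b : (LieAlgebra.IsKilling.rootSystem H).Base)
    (T : Set (Module.Dual k H)) (hT : IsPositiveSystem (roots P) T) (hTb : T ∩ delta H = deltaPos b)
    (e f : b.support → g) (hef : IsChevalley b e f)
    (lam : Module.Dual k H) (l : b.support → ℕ)
    (hlam : ∀ i, lam (simpleCoroot b i) = (l i : k)) :
    seligmanIdeal b T l = weylAnn b T f lam l ∧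
    ∃ _ : (weylAnn b T f lam l).IsTwoSided,
      ∃ φ : SeligmanAlgebra b T l ≃ₐ[k] ChariPressleyAlgebra b T f lam l,
        ∀ u : UniversalEnvelopingAlgebra k (zeroAlg H),
          φ (Ideal.Quotient.mk (seligmanIdeal b T l) u) =
            Ideal.Quotient.mk (weylAnn b T f lam l) u := by
  have h := seligmanIdeal_eq_weylAnn hL hT hTb hef hlam
  have hts : (weylAnn b T f lam l).IsTwoSided := h ▸ inferInstance
  exact ⟨h, hts, Ideal.quotientEquivAlgOfEq k h, fun _ => rfl⟩
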